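/- **Setting.** For each $n\in\mathbb N$ let $p=p_n$, $q=q_n$, $s_0=s_{0,n}$ be integers with $1\le p\le q$ and $s_0\ge 1$, and let $(X_i,Z_i,u_i)\in\mathbb R^p\times\mathbb R^q\times\mathbb R$, $i=1,\dots,n$, be i.i.d. (with a law that may depend on $n$). For $\beta_0\in\mathbb R^p$ put $Y_i=X_i'\beta_0+u_i$, and let $X$ ($n\times p$), $Z$ ($n\times q$), $Y$ be the stacked data. Let $\sigma_l^2=E Z_{1l}^2u_1^2$, $W_d=\mathrm{diag}(1/\sigma_1^2,\dots,1/\sigma_q^2)$, $\Sigma_{xz}=E X_1Z_1'$ and $$\phi^2_{\Sigma_{xzw}}(s)=\min\Big\{\frac{\delta'\Sigma_{xz}W_d\Sigma_{xz}'\delta}{q\|\delta_S\|_2^2}:\ \delta\in\mathbb R^p\setminus\{0\},\ |S|\le s,\ \|\delta_{S^c}\|_1\le 3\sqrt s\,\|\delta_S\|_2\Big\}.$$ Let $M_1=\max_{i,l}|Z_{il}u_i|$, $M_2=\max_{i,j,l}|Z_{il}X_{ij}-EZ_{il}X_{ij}|$, $M_3=\max_{i,l}|Z_{il}^2u_i^2-EZ_{il}^2u_i^2|$,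 $M_4=\max_{i,j,l}|Z_{il}^2u_iX_{ij}-EZ_{il}^2u_iX_{ij}|$, $M_5=\max_{i,j,k,l}|Z_{il}^2X_{ij}X_{ik}-EZ_{il}^2X_{ij}X_{ik}|$ with $i\le n$, $j,k\le p$, $l\le q$. **Assumption 1.** $E Z_1u_1=0$; for some exponents $r_z\ge 12$, $r_x\ge 6$, $r_u\ge 6$ the moments $E|X_{1j}|^{r_x}$, $E|Z_{1l}|^{r_z}$, $E|u_1|^{r_u}$ are at most $B$ for all $j,l,n$; and $\phi^2_{\Sigma_{xzw}}(s_0)$ and $\min_l\sigma_l^2$ are at least some $c>0$ for all $n$. **Assumption 2.** As $n\to\infty$, $s_0^2\sqrt{\ln q/n}\to0$ and $\sqrt{\ln q/n}\;\max_{1\le k\le 5}(E M_k^2)^{1/2}\to 0$. **Estimators.** For constants $K,C>0$ let $$\lambda_n=\Big[2K\Big(C\sqrt{\tfrac{\ln q}{n}}+\tfrac{\sqrt{EM_1^2}\,\ln q}{n}\Big)+\sqrt{\tfrac{\ln q}{n}}\Big]\Big[2K\Big(C\sqrt{\tfrac{\ln (pq)}{n}}+\tfrac{\sqrt{EM_2^2}\,\ln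 (pq)}{n}\Big)+\sqrt{\tfrac{\ln q}{n}}+C\Big],\qquad \lambda_n^*=\frac{2\lambda_n}{\min_{l}\sigma_l^2}.$$ The first-step estimator is $$\hat\beta_F\in\arg\min_\beta\Big[\frac{(Y-X\beta)'ZZ'(Y-X\beta)}{n^2q}+2\lambda_n\|\beta\|_1\Big];$$ with $\hat u_i=Y_i-X_i'\hat\beta_F$, $\hat\sigma_l^2=\frac1n\sum_iZ_{il}^2\hat u_i^2$ and $\hat W_d=\mathrm{diag}(1/\hat\sigma_1^2,\dots,1/\hat\sigma_q^2)$, the two-step Lasso-GMM estimator is $$\hat\beta\in\arg\min_\beta\Big[\frac{(Y-X\beta)'Z\hat W_dZ'(Y-X\beta)}{n^2q}+2\lambda_n^*\|\beta\|_1\Big].$$ **Theorem 1.** There are a universal constant $K>0$ and, for all $r_x,r_z,r_u$ and $B$ as above, a constant $C>0$ depending only on them, such that under Assumptions 1 and 2: (i) For all $n$ sufficiently large, with probability at least $$1-\frac{21}{q^C}-\frac{K\,[5EM_1^2+10EM_2^2+2EM_3^2+2EM_4^2+2EM_5^2]}{n\ln q}$$ (read as trivial if $q=1$), simultaneously for all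 $\beta_0$ with $\|\beta_0\|_{l_0}\le s_0$: the estimators exist, all $\hat\sigma_l^2$ are positive, and (for every choice of the minimizers) $$\|\hat\beta-\beta_0\|_1\le\frac{24\lambda_n^*s_0}{\phi^2_{\Sigma_{xzw}}(s_0)} .$$ (ii) $\lambda_n^*=O(\sqrt{\ln q/n})$; and if $q_n\to\infty$, the probability that (i) holds tends to one. -/

import Mathlib

open MeasureTheory ProbabilityTheory Filter Topology Asymptotics
open scoped Matrix

noncomputable section

namespace LassoGMM

/-- One observation `(X_i, Z_i, u_i)`: `p` regressors, `q` instruments, one error term. -/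
abbrev Obs (p q : ℕ) : Type := (Fin p → ℝ) × (Fin q → ℝ) × ℝ

/-- The regressors of an observation. -/
def Obs.x {p q : ℕ} (o : Obs p q) : Fin p → ℝ := o.1

/-- The instruments of an observation. -/
def Obs.z {p q : ℕ} (o : Obs p q) : Fin q → ℝ := o.2.1

/-- The error term of an observation. -/
def Obs.u {p q : ℕ} (o : Obs p q) : ℝ := o.2.2

/-- The observations `D i`, `i = 1, …, n`, are independent with common law `P`. -/
structure IsIIDSample {Ω : Type*} [MeasurableSpace Ω] {n p q : ℕ} (μ : Measure Ω)
    (P : Measure (Obs p q)) (D : Fin n → Ω → Obs p q) : Prop where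
  measurable : ∀ i, Measurable (D i)
  law : ∀ i, μ.map (D i) = P
  indep : iIndepFun D μ

section Population

variable {p q : ℕ} (P : Measure (Obs p q))

/-- `σ_l² = E Z_{1l}² u_1²`. -/
def sigmaSq (l : Fin q) : ℝ := ∫ o, o.z l ^ 2 * o.u ^ 2 ∂P

/-- `Σ_{xz} = E X_1 Z_1'`. -/
def SigmaXZ : Matrix (Fin p) (Fin q) ℝ := Matrix.of fun j l => ∫ o, o.x j * o.z l ∂P

/-- `W_d = diag(1/σ_1², …, 1/σ_q²)`. -/
def Wd : Matrix (Fin q) (Fin q) ℝ := Matrix.diagonal fun l => 1 / sigmaSq P l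

/-- The population adaptive restricted eigenvalue `φ²(s)` of `Σ_{xz} W_d Σ_{xz}'`.  For
`δ ≠ 0` in the cone, `δ_S ≠ 0`, so the quotient is never a division by zero. -/
def phiSq (s : ℕ) : ℝ :=
  sInf {r : ℝ | ∃ (δ : Fin p → ℝ) (S : Finset (Fin p)), δ ≠ 0 ∧ S.card ≤ s ∧
    ∑ j ∈ Sᶜ, |δ j| ≤ 3 * √(s : ℝ) * √(∑ j ∈ S, δ j ^ 2) ∧
    r = (δ ⬝ᵥ ((SigmaXZ P * Wd P * (SigmaXZ P)ᵀ) *ᵥ δ)) / (q * ∑ j ∈ S, δ j ^ 2)}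

/-- Exogeneity, moment bounds, and lower bounds on `φ²(s)` and on the `σ_l²`. -/
structure MomentCondition (rx rz ru B c : ℝ) (s : ℕ) : Prop where
  exogenous : ∀ l, ∫ o, o.z l * o.u ∂P = 0
  integrable_x : ∀ j, Integrable (fun o : Obs p q => |o.x j| ^ rx) P
  integrable_z : ∀ l, Integrable (fun o : Obs p q => |o.z l| ^ rz) P
  integrable_u : Integrable (fun o : Obs p q => |o.u| ^ ru) P
  moment_x : ∀ j, ∫ o, |o.x j| ^ rx ∂P ≤ B
  moment_z : ∀ l, ∫ o, |o.z l| ^ rz ∂P ≤ B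
  moment_u : ∫ o, |o.u| ^ ru ∂P ≤ B
  phiSq_ge : c ≤ phiSq P s
  sigmaSq_ge : ∀ l, c ≤ sigmaSq P l

variable {n : ℕ} (d : Fin n → Obs p q)

/-- `M_1 = max_{i,l} |Z_{il} u_i|`. -/
def M1 : ℝ := ⨆ (i : Fin n) (l : Fin q), |(d i).z l * (d i).u|

/-- `M_2 = max_{i,j,l} |Z_{il} X_{ij} - E Z_{il} X_{ij}|`. -/
def M2 : ℝ := ⨆ (i : Fin n) (j : Fin p) (l : Fin q),
  |(d i).z l * (d i).x j - ∫ o, o.z l * o.x j ∂P|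

/-- `M_3 = max_{i,l} |Z_{il}² u_i² - E Z_{il}² u_i²|`. -/
def M3 : ℝ := ⨆ (i : Fin n) (l : Fin q),
  |(d i).z l ^ 2 * (d i).u ^ 2 - ∫ o, o.z l ^ 2 * o.u ^ 2 ∂P|

/-- `M_4 = max_{i,j,l} |Z_{il}² u_i X_{ij} - E Z_{il}² u_i X_{ij}|`. -/
def M4 : ℝ := ⨆ (i : Fin n) (j : Fin p) (l : Fin q),
  |(d i).z l ^ 2 * (d i).u * (d i).x j - ∫ o, o.z l ^ 2 * o.u * o.x j ∂P|

/-- `M_5 = max_{i,j,k,l} |Z_{il}² X_{ij} X_{ik} - E Z_{il}² X_{ij} X_{ik}|`. -/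
def M5 : ℝ := ⨆ (i : Fin n) (j : Fin p) (k : Fin p) (l : Fin q),
  |(d i).z l ^ 2 * (d i).x j * (d i).x k - ∫ o, o.z l ^ 2 * o.x j * o.x k ∂P|

end Population

section Expectations

variable {Ω : Type*} [MeasurableSpace Ω] {n p q : ℕ} (μ : Measure Ω) (P : Measure (Obs p q))
  (D : Fin n → Ω → Obs p q)

/-- `E M_1²`. -/
def EM1 : ℝ := ∫ ω, M1 (fun i => D i ω) ^ 2 ∂μ

/-- `E M_2²`. -/
def EM2 : ℝ := ∫ ω, M2 P (fun i => D i ω) ^ 2 ∂μ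

/-- `E M_3²`. -/
def EM3 : ℝ := ∫ ω, M3 P (fun i => D i ω) ^ 2 ∂μ

/-- `E M_4²`. -/
def EM4 : ℝ := ∫ ω, M4 P (fun i => D i ω) ^ 2 ∂μ

/-- `E M_5²`. -/
def EM5 : ℝ := ∫ ω, M5 P (fun i => D i ω) ^ 2 ∂μ

/-- The first-step tuning parameter `λ_n`. -/
def lam (K C : ℝ) : ℝ :=
  (2 * K * (C * √(Real.log q) / √(n : ℝ) + √(EM1 μ D) * Real.log q / n)
      + √(Real.log q / n)) *
  (2 * K * (C * √(Real.log (p * q)) / √(n : ℝ) + √(EM2 μ P D) * Real.log (p * q) / n)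
      + √(Real.log q / n) + C)

/-- The second-step tuning parameter `λ_n^* = λ_n · 2 / min_l σ_l²`. -/
def lamStar (K C : ℝ) : ℝ := lam μ P D K C * (2 / ⨅ l, sigmaSq P l)

/-- `1 - 21/q^C - K [5 E M_1² + 10 E M_2² + 2 E M_3² + 2 E M_4² + 2 E M_5²] / (n ln q)`. -/
def probBound (K C : ℝ) : ℝ :=
  1 - 21 / (q : ℝ) ^ C -
    K * (5 * EM1 μ D + 10 * EM2 μ P D + 2 * EM3 μ P D + 2 * EM4 μ P D + 2 * EM5 μ P D) /
      (n * Real.log q)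

end Expectations

section Estimators

variable {n p q : ℕ}

/-- The `n × p` regressor matrix of a sample. -/
def regressors (d : Fin n → Obs p q) : Matrix (Fin n) (Fin p) ℝ := Matrix.of fun i => (d i).x

/-- The `n × q` instrument matrix of a sample. -/
def instruments (d : Fin n → Obs p q) : Matrix (Fin n) (Fin q) ℝ := Matrix.of fun i => (d i).z

/-- The outcomes `Y = X β₀ + u`. -/
def outcomes (d : Fin n → Obs p q) (β₀ : Fin p → ℝ) : Fin n → ℝ :=
  regressors d *ᵥ β₀ + fun i => (d i).u

/-- The `ℓ₁`-norm. -/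
def l1 (b : Fin p → ℝ) : ℝ := ∑ j, |b j|

/-- The number of non-zero entries. -/
def l0 (b : Fin p → ℝ) : ℕ := {j | b j ≠ 0}.ncard

variable (X : Matrix (Fin n) (Fin p) ℝ) (Z : Matrix (Fin n) (Fin q) ℝ) (Y : Fin n → ℝ)

/-- `(Y - Xb)' Z W Z' (Y - Xb) / (n² q) + 2 t ‖b‖₁`. -/
def gmmObjective (W : Matrix (Fin q) (Fin q) ℝ) (t : ℝ) (b : Fin p → ℝ) : ℝ :=
  ((Y - X *ᵥ b) ⬝ᵥ ((Z * W * Zᵀ) *ᵥ (Y - X *ᵥ b))) / ((n : ℝ) ^ 2 * q) + 2 * t * l1 b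

/-- `b` is a first-step Lasso GMM estimate (identity weight matrix). -/
def IsFirstStep (t : ℝ) (b : Fin p → ℝ) : Prop :=
  ∀ b', gmmObjective X Z Y 1 t b ≤ gmmObjective X Z Y 1 t b'

/-- `σ̂_l² = n⁻¹ ∑_i Z_{il}² û_i²` with the residuals `û = Y - X bF` of the first step. -/
def sigmaHatSq (bF : Fin p → ℝ) (l : Fin q) : ℝ :=
  (∑ i, Z i l ^ 2 * (Y i - (X *ᵥ bF) i) ^ 2) / n

/-- `Ŵ_d = diag(1/σ̂_1², …, 1/σ̂_q²)`. -/
def WdHat (bF : Fin p → ℝ) : Matrix (Fin q) (Fin q) ℝ :=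
  Matrix.diagonal fun l => 1 / sigmaHatSq X Z Y bF l

/-- `b` is a two-step Lasso GMM estimate built on the first-step estimate `bF`. -/
def IsTwoStep (bF : Fin p → ℝ) (t : ℝ) (b : Fin p → ℝ) : Prop :=
  ∀ b', gmmObjective X Z Y (WdHat X Z Y bF) t b ≤ gmmObjective X Z Y (WdHat X Z Y bF) t b'

end Estimators

end LassoGMM

end

open LassoGMM

/-! All randomness is confined to one event, on which the sample averages of Zu, ZX, Z²u², Z²uX and
Z²XX lie within ε = 2Cρ of their means, where ρ = √(log q / n). The event involves only (X, Z, u),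
so the bound proved on it holds at once for every sparse β₀ and every choice of minimisers.

On this event the argument is deterministic. Comparing the objective at a minimiser and at β₀ puts
the error δ into the cone ‖δ_{Sᶜ}‖₁ ≤ 3‖δ_S‖₁, as soon as the penalty dominates the noise. There
‖δ‖₁² ≤ 16 s ‖δ_S‖₂², so passing from population to sample cross moments changes the quadratic form
by O(sε²) and the restricted eigenvalue survives. With identity weights this gives a first-step
error O(sρ). Each σ̂² is a quadratic polynomial in that error with sample moments as coefficients,
hence lies between σ²/2 and 2σ². The same lemma, `l1_sub_le_of_minimiser`, then applies to the
estimated weights and gives `twoStep_oracle`.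

The probability comes from `measureReal_exists_lt_abs_sum_le`. Each observation vector is truncated
at norm 1/ρ. The truncated sums obey a Chernoff bound with a union over at most q³ coordinates,
which costs a multiple of q^{-C}. The removed parts are dominated, in all coordinates
simultaneously, by one scalar sum whose second moment is at most 16/9 E M² by an argument of
Hoffmann-Jørgensen type; Chebyshev turns this into the term E M²/(n log q).

Finally `le_lam` and `lam_le` show that λ_n exceeds the noise level on the event and is still O(ρ).
-/

namespace LassoGMM

/-! ### Large values of independent variables under a square-integrable envelope -/

section MaximalInequality

/-- The value `y` where it exceeds the level `τ`, and `0` elsewhere. -/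
noncomputable def exceed (τ y : ℝ) : ℝ := if τ < y then y else 0

theorem measurable_exceed (τ : ℝ) : Measurable (exceed τ) :=
  Measurable.ite measurableSet_Ioi measurable_id measurable_const

theorem exceed_nonneg {τ : ℝ} {y : ℝ} (hy : 0 ≤ y) : 0 ≤ exceed τ y := by
  unfold exceed; split_ifs <;> simp [hy]

theorem exceed_le {τ : ℝ} {y : ℝ} (hy : 0 ≤ y) : exceed τ y ≤ y := by
  unfold exceed; split_ifs <;> simp [hy]

theorem exceed_le_sq_div {τ : ℝ} (hτ : 0 < τ) (y : ℝ) : exceed τ y ≤ exceed τ y ^ 2 / τ := by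
  unfold exceed
  split_ifs with h
  · rw [le_div_iff₀ hτ]; nlinarith
  · simp

variable {Ω : Type*} [MeasurableSpace Ω] {μ : Measure Ω}

theorem integrable_of_sq [IsProbabilityMeasure μ] {f : Ω → ℝ} (hf : AEStronglyMeasurable f μ)
    (h : Integrable (fun ω => f ω ^ 2) μ) : Integrable f μ :=
  ((memLp_two_iff_integrable_sq hf).2 h).integrable one_le_two

variable {n : ℕ} {Y : Fin n → Ω → ℝ} {M : Ω → ℝ} {τ : ℝ}

theorem integrable_exceed_sq (hY : ∀ i, Measurable (Y i)) (hY0 : ∀ i ω, 0 ≤ Y i ω)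
    (hYM : ∀ i ω, Y i ω ≤ M ω) (hM : Integrable (fun ω => M ω ^ 2) μ) (i : Fin n) :
    Integrable (fun ω => exceed τ (Y i ω) ^ 2) μ := by
  refine hM.mono' (((measurable_exceed τ).comp (hY i)).pow_const 2).aestronglyMeasurable ?_
  refine Eventually.of_forall fun ω => ?_
  rw [Real.norm_of_nonneg (sq_nonneg _)]
  exact pow_le_pow_left₀ (exceed_nonneg (hY0 i ω)) ((exceed_le (hY0 i ω)).trans (hYM i ω)) 2

variable [IsProbabilityMeasure μ]

/-- Markov's inequality for M²: a level τ of at least twice the L² norm of M is exceeded with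
probability at most 1/4. -/
theorem three_quarters_le_measureReal_le (hM : Integrable (fun ω => M ω ^ 2) μ)
    (hτ : 0 < τ) (h4 : 4 * ∫ ω, M ω ^ 2 ∂μ ≤ τ ^ 2) {B : Set Ω} (hB : MeasurableSet B)
    (hsub : ∀ ω, M ω ≤ τ → ω ∈ B) : 3 / 4 ≤ μ.real B := by
  have h1 := mul_meas_ge_le_integral_of_nonneg (μ := μ) (f := fun ω => M ω ^ 2)
    (Eventually.of_forall fun ω => sq_nonneg _) hM (τ ^ 2)
  have h2 : μ.real Bᶜ ≤ μ.real {ω | τ ^ 2 ≤ M ω ^ 2} := by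
    refine measureReal_mono fun ω hω => ?_
    have : τ < M ω := lt_of_not_ge fun h => hω (hsub ω h)
    exact pow_le_pow_left₀ hτ.le this.le 2
  rw [probReal_compl_eq_one_sub hB] at h2
  have h3 : 0 < τ ^ 2 := by positivity
  change τ ^ 2 * μ.real _ ≤ _ at h1
  by_contra! hlt
  nlinarith

/-- Let `B i` be the event that every variable other than the i-th stays below τ. It is independent
of `Y i` and has probability at least 3/4. At most one index can exceed τ while its `B i` holds, so
the exceedances restricted to the `B i` sum to at most M² pointwise. Dividing by 3/4 removes the
restriction. -/
theorem sum_integral_exceed_sq_le (hY : ∀ i, Measurable (Y i)) (hind : iIndepFun Y μ)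
    (hY0 : ∀ i ω, 0 ≤ Y i ω) (hYM : ∀ i ω, Y i ω ≤ M ω) (hM : Integrable (fun ω => M ω ^ 2) μ)
    (hτ : 0 < τ) (h4 : 4 * ∫ ω, M ω ^ 2 ∂μ ≤ τ ^ 2) :
    ∑ i, ∫ ω, exceed τ (Y i ω) ^ 2 ∂μ ≤ 4 / 3 * ∫ ω, M ω ^ 2 ∂μ := by
  set B : Fin n → Set Ω := fun i => {ω | ∀ k ∈ Finset.univ.erase i, Y k ω ≤ τ}
  have hBm : ∀ i, MeasurableSet (B i) := fun i => by
    have : B i = ⋂ k ∈ Finset.univ.erase i, {ω | Y k ω ≤ τ} := by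
      ext ω; simp [B]
    rw [this]
    exact Finset.measurableSet_biInter _ fun k _ => measurableSet_le (hY k) measurable_const
  have hE := integrable_exceed_sq (τ := τ) hY hY0 hYM hM
  have hprod : ∀ i, ∫ ω, exceed τ (Y i ω) ^ 2 * (B i).indicator 1 ω ∂μ =
      (∫ ω, exceed τ (Y i ω) ^ 2 ∂μ) * μ.real (B i) := fun i => by
    have hI := hind.indepFun_finset {i} (Finset.univ.erase i) (by simp) hY
    have hS : MeasurableSet {v : ↥(Finset.univ.erase i) → ℝ | ∀ k, v k ≤ τ} := by
      rw [Set.ofPred_forall]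
      exact MeasurableSet.iInter fun k => measurableSet_le (measurable_pi_apply k) measurable_const
    have hφ : Measurable fun v : ↥({i} : Finset (Fin n)) → ℝ => exceed τ (v ⟨i, by simp⟩) ^ 2 :=
      ((measurable_exceed τ).comp (measurable_pi_apply _)).pow_const 2
    have hψ : Measurable (Set.indicator {v : ↥(Finset.univ.erase i) → ℝ | ∀ k, v k ≤ τ}
        (fun _ => (1 : ℝ))) := measurable_const.indicator hS
    have hI2 := hI.comp (φ := fun v => exceed τ (v ⟨i, by simp⟩) ^ 2)
      (ψ := Set.indicator {v | ∀ k, v k ≤ τ} (fun _ => (1 : ℝ)))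
      hφ hψ
    have e2 : (Set.indicator {v : ↥(Finset.univ.erase i) → ℝ | ∀ k, v k ≤ τ}
        (fun _ => (1 : ℝ))) ∘ (fun a (k : ↥(Finset.univ.erase i)) => Y k a) =
        (B i).indicator 1 := by
      ext ω
      simp [Set.indicator, B]
    rw [e2] at hI2
    have := hI2.integral_fun_mul_eq_mul_integral
      (((measurable_exceed τ).comp (hY i)).pow_const 2).aestronglyMeasurable
      (measurable_one.indicator (hBm i)).aestronglyMeasurable
    rw [integral_indicator_one (hBm i)] at this
    exact this
  have hmul : ∀ i, Integrable (fun ω => exceed τ (Y i ω) ^ 2 * (B i).indicator 1 ω) μ := fun i => by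
    refine (hE i).mono' (((((measurable_exceed τ).comp (hY i)).pow_const 2)).mul
      (measurable_one.indicator (hBm i))).aestronglyMeasurable (Eventually.of_forall fun ω => ?_)
    by_cases h : ω ∈ B i <;> simp [h, sq_nonneg]
  have hpt : ∀ ω, ∑ i, exceed τ (Y i ω) ^ 2 * (B i).indicator 1 ω ≤ M ω ^ 2 := fun ω => by
    by_cases h : ∃ i, τ < Y i ω
    · obtain ⟨i, hi⟩ := h
      rw [Finset.sum_eq_single i]
      · calc exceed τ (Y i ω) ^ 2 * (B i).indicator 1 ω ≤ exceed τ (Y i ω) ^ 2 := by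
              by_cases h : ω ∈ B i <;> simp [h, sq_nonneg]
          _ ≤ _ := pow_le_pow_left₀ (exceed_nonneg (hY0 i ω))
              ((exceed_le (hY0 i ω)).trans (hYM i ω)) 2
      · intro k _ hk
        -- If the i-th variable exceeds τ, every `B k` with k ≠ i fails, so a single summand
        -- remains.
        have : ω ∉ B k := fun hB => absurd (hB i (by simp [hk.symm])) (not_le.2 hi)
        simp [this]
      · simp
    · push Not at h
      have : ∀ i, exceed τ (Y i ω) = 0 := fun i => if_neg (not_lt.2 (h i))
      simp [this, sq_nonneg]
  have h34 : ∀ i, 3 / 4 ≤ μ.real (B i) := fun i =>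
    three_quarters_le_measureReal_le hM hτ h4 (hBm i) fun ω hω k _ => (hYM k ω).trans hω
  have key : ∑ i, (∫ ω, exceed τ (Y i ω) ^ 2 ∂μ) * μ.real (B i) ≤ ∫ ω, M ω ^ 2 ∂μ := by
    simp_rw [← hprod]
    rw [← integral_finsetSum _ fun i _ => hmul i]
    exact integral_mono (integrable_finsetSum _ fun i _ => hmul i) hM hpt
  have : ∑ i, (∫ ω, exceed τ (Y i ω) ^ 2 ∂μ) * (3 / 4) ≤
      ∑ i, (∫ ω, exceed τ (Y i ω) ^ 2 ∂μ) * μ.real (B i) :=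
    Finset.sum_le_sum fun i _ => mul_le_mul_of_nonneg_left (h34 i)
      (integral_nonneg fun ω => sq_nonneg _)
  rw [← Finset.sum_mul] at this
  linarith

theorem integrable_exceed (hY : ∀ i, Measurable (Y i)) (hY0 : ∀ i ω, 0 ≤ Y i ω)
    (hYM : ∀ i ω, Y i ω ≤ M ω) (hM : Integrable (fun ω => M ω ^ 2) μ) (i : Fin n) :
    Integrable (fun ω => exceed τ (Y i ω)) μ :=
  integrable_of_sq ((measurable_exceed τ).comp (hY i)).aestronglyMeasurable
    (integrable_exceed_sq hY hY0 hYM hM i)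

theorem sum_integral_exceed_le (hY : ∀ i, Measurable (Y i)) (hind : iIndepFun Y μ)
    (hY0 : ∀ i ω, 0 ≤ Y i ω) (hYM : ∀ i ω, Y i ω ≤ M ω) (hM : Integrable (fun ω => M ω ^ 2) μ)
    (hτ : 0 < τ) (h4 : 4 * ∫ ω, M ω ^ 2 ∂μ ≤ τ ^ 2) :
    ∑ i, ∫ ω, exceed τ (Y i ω) ∂μ ≤ 4 / 3 * (∫ ω, M ω ^ 2 ∂μ) / τ := by
  have h1 := sum_integral_exceed_sq_le hY hind hY0 hYM hM hτ h4
  calc ∑ i, ∫ ω, exceed τ (Y i ω) ∂μ ≤ ∑ i, (∫ ω, exceed τ (Y i ω) ^ 2 ∂μ) / τ := by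
        refine Finset.sum_le_sum fun i _ => ?_
        rw [← integral_div]
        exact integral_mono (integrable_exceed hY hY0 hYM hM i)
          ((integrable_exceed_sq hY hY0 hYM hM i).div_const _) fun ω => exceed_le_sq_div hτ _
    _ ≤ _ := by
        rw [← Finset.sum_div]
        gcongr

/-- Second moment = variance + squared mean. By independence the variance is at most 4/3 E M²; the
squared mean is at most (4/3 E M²/τ)² ≤ 4/9 E M², since 4 E M² ≤ τ². -/
theorem integral_sum_exceed_sq_le (hY : ∀ i, Measurable (Y i)) (hind : iIndepFun Y μ)
    (hY0 : ∀ i ω, 0 ≤ Y i ω) (hYM : ∀ i ω, Y i ω ≤ M ω) (hM : Integrable (fun ω => M ω ^ 2) μ)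
    (hτ : 0 < τ) (h4 : 4 * ∫ ω, M ω ^ 2 ∂μ ≤ τ ^ 2) :
    ∫ ω, (∑ i, exceed τ (Y i ω)) ^ 2 ∂μ ≤ 16 / 9 * ∫ ω, M ω ^ 2 ∂μ := by
  have h1 := sum_integral_exceed_sq_le hY hind hY0 hYM hM hτ h4
  have h2 := sum_integral_exceed_le hY hind hY0 hYM hM hτ h4
  have hL : ∀ i, MemLp (fun ω => exceed τ (Y i ω)) 2 μ := fun i =>
    (memLp_two_iff_integrable_sq ((measurable_exceed τ).comp (hY i)).aestronglyMeasurable).2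
      (integrable_exceed_sq hY hY0 hYM hM i)
  have hind2 : iIndepFun (fun i ω => exceed τ (Y i ω)) μ :=
    hind.comp (fun _ => exceed τ) fun _ => measurable_exceed τ
  have hv := IndepFun.variance_sum (μ := μ) (X := fun i ω => exceed τ (Y i ω))
    (s := Finset.univ) (fun i _ => hL i) (fun i _ j _ hij => hind2.indepFun hij)
  rw [variance_eq_sub (memLp_finsetSum' _ fun i _ => hL i)] at hv
  have hv2 : ∑ i, variance (fun ω => exceed τ (Y i ω)) μ ≤
      ∑ i, ∫ ω, exceed τ (Y i ω) ^ 2 ∂μ := Finset.sum_le_sum fun i _ => by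
    rw [variance_eq_sub (hL i)]
    simp only [Pi.pow_apply]
    linarith [sq_nonneg (∫ ω, exceed τ (Y i ω) ∂μ)]
  simp only [Pi.pow_apply, Finset.sum_apply] at hv
  rw [integral_finsetSum _ fun i _ => integrable_exceed hY hY0 hYM hM i] at hv
  have h0 : 0 ≤ ∑ i, ∫ ω, exceed τ (Y i ω) ∂μ :=
    Finset.sum_nonneg fun i _ => integral_nonneg fun ω => exceed_nonneg (hY0 i ω)
  have hE0 : 0 ≤ ∫ ω, M ω ^ 2 ∂μ := integral_nonneg fun ω => sq_nonneg _
  have h3 : (∑ i, ∫ ω, exceed τ (Y i ω) ∂μ) ^ 2 ≤ 4 / 9 * ∫ ω, M ω ^ 2 ∂μ := by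
    refine (pow_le_pow_left₀ h0 h2 2).trans ?_
    rw [div_pow, div_le_iff₀ (by positivity)]
    nlinarith
  linarith

theorem exp_le_one_add_add_sq {x : ℝ} (hx : |x| ≤ 1) : Real.exp x ≤ 1 + x + x ^ 2 := by
  have := Real.abs_exp_sub_one_sub_id_le hx
  linarith [(abs_le.1 this).2]

/-- Exponential bound for a sum of independent truncated variables with small positive mean. -/
theorem measureReal_truncated_sum_ge_le {ζ : Fin n → Ω → ℝ} {ρ V : ℝ} {b : Fin n → ℝ}
    (hζ : ∀ i, Measurable (ζ i)) (hind : iIndepFun ζ μ) (hρ : 0 < ρ)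
    (hb : ∀ i ω, |ρ * ζ i ω| ≤ 1) (hmean : ∀ i, ∫ ω, ζ i ω ∂μ ≤ b i)
    (hvar : ∀ i, ∫ ω, ζ i ω ^ 2 ∂μ ≤ V) (t : ℝ) :
    μ.real {ω | t ≤ ∑ i, ζ i ω} ≤ Real.exp (-ρ * t + ρ * ∑ i, b i + n * (ρ ^ 2 * V)) := by
  have hbd : ∀ i ω, ‖ζ i ω‖ ≤ 1 / ρ := fun i ω => by
    rw [Real.norm_eq_abs, le_div_iff₀ hρ]
    have := hb i ω
    rw [abs_mul, abs_of_pos hρ] at this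
    linarith
  have hint : ∀ i, Integrable (ζ i) μ := fun i =>
    Integrable.of_bound (hζ i).aestronglyMeasurable (1 / ρ) (Eventually.of_forall (hbd i))
  have hint2 : ∀ i, Integrable (fun ω => ζ i ω ^ 2) μ := fun i =>
    Integrable.of_bound ((hζ i).pow_const 2).aestronglyMeasurable ((1 / ρ) ^ 2)
      (Eventually.of_forall fun ω => by
        rw [norm_pow]; exact pow_le_pow_left₀ (norm_nonneg _) (hbd i ω) 2)
  have hmgf : ∀ i, mgf (ζ i) μ ρ ≤ Real.exp (ρ * b i + ρ ^ 2 * V) := fun i => by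
    have hexp : Integrable (fun ω => Real.exp (ρ * ζ i ω)) μ :=
      Integrable.of_bound (by fun_prop) (Real.exp 1) (Eventually.of_forall fun ω => by
        rw [Real.norm_of_nonneg (Real.exp_pos _).le]
        exact Real.exp_le_exp.2 (abs_le.1 (hb i ω)).2)
    calc mgf (ζ i) μ ρ ≤ ∫ ω, (1 + ρ * ζ i ω + ρ ^ 2 * ζ i ω ^ 2) ∂μ := by
          refine integral_mono hexp (((integrable_const _).add ((hint i).const_mul _)).add
            ((hint2 i).const_mul _)) fun ω => ?_
          have := exp_le_one_add_add_sq (hb i ω)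
          rw [mul_pow] at this
          exact this
      _ = 1 + ρ * ∫ ω, ζ i ω ∂μ + ρ ^ 2 * ∫ ω, ζ i ω ^ 2 ∂μ := by
          have h1 : Integrable (fun ω => 1 + ρ * ζ i ω) μ :=
            (integrable_const _).add ((hint i).const_mul _)
          rw [integral_add h1 ((hint2 i).const_mul _),
            integral_add (integrable_const _) ((hint i).const_mul _), integral_const_mul,
            integral_const_mul]
          simp
      _ ≤ ρ * b i + ρ ^ 2 * V + 1 := by
          have := mul_le_mul_of_nonneg_left (hmean i) hρ.le
          have := mul_le_mul_of_nonneg_left (hvar i) (sq_nonneg ρ)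
          linarith
      _ ≤ _ := Real.add_one_le_exp _
  have hint3 : Integrable (fun ω => Real.exp (ρ * (∑ i, ζ i) ω)) μ := by
    refine Integrable.of_bound (C := Real.exp (∑ _i : Fin n, 1)) ?_ ?_
    · have : Measurable (fun ω => (∑ i, ζ i) ω) := by
        simp only [Finset.sum_apply]
        fun_prop
      fun_prop
    · refine Eventually.of_forall fun ω => ?_
      rw [Real.norm_of_nonneg (Real.exp_pos _).le, Finset.sum_apply, Finset.mul_sum]
      exact Real.exp_le_exp.2 (Finset.sum_le_sum fun i _ => (abs_le.1 (hb i ω)).2)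
  have h := measure_ge_le_exp_mul_mgf (μ := μ) t hρ.le hint3
  rw [hind.mgf_sum hζ] at h
  simp only [Finset.sum_apply] at h
  refine h.trans ?_
  calc _ ≤ Real.exp (-ρ * t) * ∏ i, Real.exp (ρ * b i + ρ ^ 2 * V) := by
        refine mul_le_mul_of_nonneg_left ?_ (Real.exp_pos _).le
        exact Finset.prod_le_prod (fun i _ => mgf_nonneg) fun i _ => hmgf i
    _ = _ := by
        rw [← Real.exp_sum, ← Real.exp_add, Finset.sum_add_distrib, ← Finset.mul_sum]
        simp
        ring

end MaximalInequality

/-- The square of a finite maximum is dominated by the sum of the squares. This makes the M_k²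
integrable, so that each E M_k² is a genuine expectation and not the default value 0 of the
integral. -/
theorem integrable_sq_iSup {Ω : Type*} [MeasurableSpace Ω] {μ : Measure Ω} {ι : Type*}
    [Finite ι] {g : ι → Ω → ℝ}
    (hg : ∀ i, Measurable (g i)) (hint : ∀ i, Integrable (fun ω => g i ω ^ 2) μ) :
    Integrable (fun ω => (⨆ i, g i ω) ^ 2) μ := by
  cases nonempty_fintype ι
  refine (integrable_finsetSum Finset.univ fun i _ => hint i).mono'
    ((Measurable.iSup hg).pow_const 2).aestronglyMeasurable (Eventually.of_forall fun ω => ?_)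
  rw [Real.norm_of_nonneg (sq_nonneg _)]
  rcases isEmpty_or_nonempty ι with h | h
  · simp [Real.iSup_of_isEmpty]
  · obtain ⟨i, hi⟩ := exists_eq_ciSup_of_finite (f := fun i => g i ω)
    rw [← hi]
    exact Finset.single_le_sum (f := fun i => g i ω ^ 2) (fun i _ => sq_nonneg _)
      (Finset.mem_univ i)

/-! ### The maximal inequality by truncation of vectors -/

section MaximalInequality

variable {Ω : Type*} [MeasurableSpace Ω] {μ : Measure Ω} [IsProbabilityMeasure μ]

/-- The `j`-th coordinate of `v` if `‖v‖ ≤ τ`, and `0` otherwise. -/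
noncomputable def trunc {ι : Type*} [Fintype ι] (τ : ℝ) (j : ι) (v : ι → ℝ) : ℝ :=
  if τ < ‖v‖ then 0 else v j

section trunc

variable {ι : Type*} [Fintype ι] (τ : ℝ) (j : ι)

theorem measurable_trunc : Measurable (trunc τ j) :=
  Measurable.ite (measurableSet_lt measurable_const measurable_norm) measurable_const
    (measurable_pi_apply j)

/-- Truncating by the norm of the whole vector makes the error bound free of j; the removed part
therefore needs no union bound. -/
theorem abs_sub_trunc_le (v : ι → ℝ) : |v j - trunc τ j v| ≤ exceed τ ‖v‖ := by
  unfold trunc exceed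
  split_ifs
  · simpa using norm_le_pi_norm v j
  · simp

theorem abs_trunc_le {τ : ℝ} (hτ : 0 ≤ τ) (v : ι → ℝ) : |trunc τ j v| ≤ τ := by
  unfold trunc
  split_ifs with h
  · simpa using hτ
  · exact (norm_le_pi_norm v j).trans (not_lt.1 h)

theorem trunc_sq_le (v : ι → ℝ) : trunc τ j v ^ 2 ≤ v j ^ 2 := by
  unfold trunc
  split_ifs
  · simpa using sq_nonneg (v j)
  · exact le_rfl

end trunc

/-- A maximal inequality for sums of independent centred random vectors, with an exponential
term governed by the variances and a polynomial term governed by the second moment of an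
envelope. -/
theorem measureReal_exists_lt_abs_sum_le {ι : Type*} [Fintype ι] {n : ℕ} (hn : 0 < n)
    {ξ : Fin n → Ω → ι → ℝ} {M : Ω → ℝ} {V ρ : ℝ}
    (hξ : ∀ i, Measurable (ξ i)) (hind : iIndepFun ξ μ)
    (hmean : ∀ i j, ∫ ω, ξ i ω j ∂μ = 0) (hvar : ∀ i j, ∫ ω, ξ i ω j ^ 2 ∂μ ≤ V)
    (hM0 : ∀ ω, 0 ≤ M ω) (hξM : ∀ i ω j, |ξ i ω j| ≤ M ω)
    (hM : Integrable (fun ω => M ω ^ 2) μ) (hρ : 0 < ρ)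
    (h4 : 4 * ρ ^ 2 * ∫ ω, M ω ^ 2 ∂μ ≤ 1) (a : ℝ) :
    μ.real {ω | ∃ j, (a + 1) * (n * ρ) < |∑ i, ξ i ω j|} ≤
      2 * Fintype.card ι * Real.exp (-(a - V) * (n * ρ ^ 2) + 1 / 3) +
        16 / 9 * (∫ ω, M ω ^ 2 ∂μ) / (n * ρ) ^ 2 := by
  have hn' : (0 : ℝ) < n := by exact_mod_cast hn
  set E := ∫ ω, M ω ^ 2 ∂μ
  set Y : Fin n → Ω → ℝ := fun i ω => ‖ξ i ω‖
  -- The level 1/ρ keeps ρ times a truncated coordinate in [-1, 1], where exp x ≤ 1 + x + x² is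
  -- available; `h4` becomes 4E ≤ τ².
  set τ : ℝ := 1 / ρ with hτdef
  have hτ : 0 < τ := by positivity
  have h4' : 4 * E ≤ τ ^ 2 := by
    rw [hτdef, div_pow, one_pow, le_div_iff₀ (by positivity)]
    linarith
  have hY : ∀ i, Measurable (Y i) := fun i => (hξ i).norm
  have hYind : iIndepFun Y μ := hind.comp (fun _ => norm) fun _ => measurable_norm
  have hY0 : ∀ i ω, 0 ≤ Y i ω := fun i ω => norm_nonneg _
  have hYM : ∀ i ω, Y i ω ≤ M ω := fun i ω =>
    (pi_norm_le_iff_of_nonneg (hM0 ω)).2 fun j => hξM i ω j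
  have hexc := integrable_exceed (τ := τ) hY hY0 hYM hM
  have hsum := sum_integral_exceed_le hY hYind hY0 hYM hM hτ h4'
  have hR := integral_sum_exceed_sq_le hY hYind hY0 hYM hM hτ h4'
  have hmeasj : ∀ i j, Measurable fun ω => ξ i ω j := fun i j => (measurable_pi_apply j).comp (hξ i)
  have hint2 : ∀ i j, Integrable (fun ω => ξ i ω j ^ 2) μ := fun i j =>
    hM.mono' ((hmeasj i j).pow_const 2).aestronglyMeasurable (Eventually.of_forall fun ω => by
      rw [norm_pow]; exact pow_le_pow_left₀ (norm_nonneg _) (hξM i ω j) 2)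
  have hint : ∀ i j, Integrable (fun ω => ξ i ω j) μ := fun i j =>
    integrable_of_sq (hmeasj i j).aestronglyMeasurable (hint2 i j)
  have htm : ∀ i j, Measurable fun ω => trunc τ j (ξ i ω) := fun i j =>
    (measurable_trunc τ j).comp (hξ i)
  have htint : ∀ i j, Integrable (fun ω => trunc τ j (ξ i ω)) μ := fun i j =>
    Integrable.of_bound (htm i j).aestronglyMeasurable τ
      (Eventually.of_forall fun ω => abs_trunc_le j hτ.le _)
  have htmean : ∀ i j, |∫ ω, trunc τ j (ξ i ω) ∂μ| ≤ ∫ ω, exceed τ (Y i ω) ∂μ := fun i j => by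
    -- The coordinates are centred, so the mean of the truncated part is minus that of the removed
    -- part.
    have : ∫ ω, trunc τ j (ξ i ω) ∂μ = -∫ ω, (ξ i ω j - trunc τ j (ξ i ω)) ∂μ := by
      rw [integral_sub (hint i j) (htint i j), hmean]; ring
    rw [this, abs_neg]
    exact (abs_integral_le_integral_abs).trans (integral_mono ((hint i j).sub (htint i j)).abs
      (hexc i) fun ω => abs_sub_trunc_le τ j _)
  have htvar : ∀ i j, ∫ ω, trunc τ j (ξ i ω) ^ 2 ∂μ ≤ V := fun i j =>
    (integral_mono (Integrable.of_bound ((htm i j).pow_const 2).aestronglyMeasurable (τ ^ 2)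
      (Eventually.of_forall fun ω => by
        rw [norm_pow]; exact pow_le_pow_left₀ (norm_nonneg _) (abs_trunc_le j hτ.le _) 2))
      (hint2 i j) fun ω => trunc_sq_le τ j _).trans (hvar i j)
  have htail : ∀ j (σ : ℝ), |σ| = 1 → μ.real {ω | a * (n * ρ) ≤ ∑ i, σ * trunc τ j (ξ i ω)} ≤
      Real.exp (-(a - V) * (n * ρ ^ 2) + 1 / 3) := fun j σ hσ => by
    refine (measureReal_truncated_sum_ge_le (ζ := fun i ω => σ * trunc τ j (ξ i ω)) (ρ := ρ) (V := V)
      (b := fun i => ∫ ω, exceed τ (Y i ω) ∂μ) (fun i => (htm i j).const_mul σ)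
      (hind.comp (fun _ v => σ * trunc τ j v) fun _ => (measurable_trunc τ j).const_mul σ) hρ
      (fun i ω => ?_) (fun i => ?_) (fun i => ?_) _).trans (Real.exp_le_exp.2 ?_)
    · rw [abs_mul, abs_mul, hσ, one_mul, abs_of_pos hρ]
      calc ρ * |trunc τ j (ξ i ω)| ≤ ρ * τ := by gcongr; exact abs_trunc_le j hτ.le _
        _ = 1 := by rw [hτdef]; field_simp
    · rw [integral_const_mul]
      refine (le_abs_self _).trans ?_
      rw [abs_mul, hσ, one_mul]
      exact htmean i j
    · have : ∀ ω, (σ * trunc τ j (ξ i ω)) ^ 2 = trunc τ j (ξ i ω) ^ 2 := fun ω => by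
        rw [mul_pow, ← sq_abs σ, hσ]; ring
      simp_rw [this]
      exact htvar i j
    -- The bias left by truncation adds at most ρ · (4/3) E ρ ≤ 1/3 to the exponent.
    · have h1 : ρ * ∑ i, ∫ ω, exceed τ (Y i ω) ∂μ ≤ 1 / 3 := by
        refine (mul_le_mul_of_nonneg_left hsum hρ.le).trans ?_
        rw [hτdef]
        field_simp
        linarith
      nlinarith
  have hRtail : μ.real {ω | (n * ρ) ^ 2 ≤ (∑ i, exceed τ (Y i ω)) ^ 2} ≤
      16 / 9 * E / (n * ρ) ^ 2 := by
    have hRint : Integrable (fun ω => (∑ i, exceed τ (Y i ω)) ^ 2) μ := by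
      refine MemLp.integrable_sq (f := fun ω => ∑ i, exceed τ (Y i ω)) ?_
      exact memLp_finsetSum _ fun i _ =>
        (memLp_two_iff_integrable_sq ((measurable_exceed τ).comp (hY i)).aestronglyMeasurable).2
        (integrable_exceed_sq hY hY0 hYM hM i)
    have h := mul_meas_ge_le_integral_of_nonneg (μ := μ)
      (Eventually.of_forall fun ω => sq_nonneg _) hRint ((n * ρ) ^ 2)
    rw [le_div_iff₀ (by positivity), mul_comm]
    exact h.trans hR
  -- The threshold is split: a·nρ for the truncated sum, with either sign, and nρ for the removed
  -- part.
  have hsub : {ω | ∃ j, (a + 1) * (n * ρ) < |∑ i, ξ i ω j|} ⊆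
      (⋃ j ∈ (Finset.univ : Finset ι), ({ω | a * (n * ρ) ≤ ∑ i, 1 * trunc τ j (ξ i ω)} ∪
        {ω | a * (n * ρ) ≤ ∑ i, -1 * trunc τ j (ξ i ω)})) ∪
        {ω | (n * ρ) ^ 2 ≤ (∑ i, exceed τ (Y i ω)) ^ 2} := by
    rintro ω ⟨j, hj⟩
    by_contra hcon
    simp only [Set.mem_union, Set.mem_iUnion, Set.mem_ofPred_eq, not_or, not_exists, not_le,
      one_mul, neg_one_mul, Finset.sum_neg_distrib] at hcon
    obtain ⟨h1, h2⟩ := hcon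
    obtain ⟨h1, h3⟩ := h1 j (Finset.mem_univ j)
    have h4 := lt_of_pow_lt_pow_left₀ 2 (by positivity) h2
    have h5 : |∑ i, ξ i ω j - ∑ i, trunc τ j (ξ i ω)| ≤ ∑ i, exceed τ (Y i ω) := by
      rw [← Finset.sum_sub_distrib]
      exact (Finset.abs_sum_le_sum_abs _ _).trans
        (Finset.sum_le_sum fun i _ => abs_sub_trunc_le τ j _)
    have h6 : |∑ i, trunc τ j (ξ i ω)| < a * (n * ρ) := abs_lt.2 ⟨by linarith, h1⟩
    have h7 := abs_sub_abs_le_abs_sub (∑ i, ξ i ω j) (∑ i, trunc τ j (ξ i ω))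
    linarith
  calc _ ≤ _ := measureReal_mono hsub
    _ ≤ _ := measureReal_union_le _ _
    _ ≤ (∑ _j : ι, 2 * Real.exp (-(a - V) * (n * ρ ^ 2) + 1 / 3)) +
        16 / 9 * E / (n * ρ) ^ 2 := by
        refine add_le_add ((measureReal_biUnion_finset_le _ _).trans
          (Finset.sum_le_sum fun j _ => ?_)) hRtail
        refine (measureReal_union_le _ _).trans ?_
        linarith [htail j 1 (by simp), htail j (-1) (by simp)]
    _ = _ := by
        simp
        ring

end MaximalInequality

/-! ### The Lasso with a diagonal weight matrix: basic inequality and restricted eigenvalues -/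

section Lasso

variable {n p q : ℕ}

theorem dotProduct_mul_diagonal_mulVec {m : Type*} [Fintype m] (A : Matrix m (Fin q) ℝ)
    (w : Fin q → ℝ) (v : m → ℝ) :
    v ⬝ᵥ ((A * Matrix.diagonal w * Aᵀ) *ᵥ v) = ∑ l, w l * (∑ i, A i l * v i) ^ 2 := by
  have h1 : ∀ l, (v ᵥ* A) l = ∑ i, A i l * v i := fun l => by
    simp [Matrix.vecMul, dotProduct, mul_comm]
  rw [Matrix.dotProduct_mulVec, ← Matrix.vecMul_vecMul, ← Matrix.vecMul_vecMul,
    ← Matrix.dotProduct_mulVec, Matrix.mulVec_transpose, dotProduct]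
  refine Finset.sum_congr rfl fun l _ => ?_
  rw [Matrix.vecMul_diagonal, h1]
  ring

theorem gmmObjective_diagonal (X : Matrix (Fin n) (Fin p) ℝ) (Z : Matrix (Fin n) (Fin q) ℝ)
    (Y : Fin n → ℝ) (w : Fin q → ℝ) (t : ℝ) (b : Fin p → ℝ) :
    gmmObjective X Z Y (Matrix.diagonal w) t b =
      (∑ l, w l * (∑ i, Z i l * (Y i - (X *ᵥ b) i)) ^ 2) / ((n : ℝ) ^ 2 * q) + 2 * t * l1 b := by
  unfold gmmObjective
  rw [dotProduct_mul_diagonal_mulVec]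
  rfl

theorem norm_le_l1 (b : Fin p → ℝ) : ‖b‖ ≤ l1 b := by
  refine (pi_norm_le_iff_of_nonneg (Finset.sum_nonneg fun j _ => abs_nonneg _)).2 fun j => ?_
  exact Finset.single_le_sum (f := fun j => |b j|) (fun j _ => abs_nonneg _) (Finset.mem_univ j)

/-- The quadratic part is nonnegative and the ℓ₁ penalty with t > 0 is coercive, so a continuous
function on a proper space attains its minimum. -/
theorem exists_gmmObjective_minimiser (X : Matrix (Fin n) (Fin p) ℝ)
    (Z : Matrix (Fin n) (Fin q) ℝ) (Y : Fin n → ℝ) {w : Fin q → ℝ} (hw : ∀ l, 0 ≤ w l) {t : ℝ}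
    (ht : 0 < t) :
    ∃ b, ∀ b', gmmObjective X Z Y (Matrix.diagonal w) t b ≤
      gmmObjective X Z Y (Matrix.diagonal w) t b' := by
  refine Continuous.exists_forall_le ?_ ?_
  · simp_rw [funext fun b => gmmObjective_diagonal X Z Y w t b]
    unfold l1 Matrix.mulVec dotProduct
    fun_prop
  · refine tendsto_atTop_mono (fun b => ?_)
      ((tendsto_norm_cocompact_atTop (E := Fin p → ℝ)).const_mul_atTop
        (show 0 < 2 * t by positivity))
    rw [gmmObjective_diagonal]
    have h1 : 0 ≤ (∑ l, w l * (∑ i, Z i l * (Y i - (X *ᵥ b) i)) ^ 2) / ((n : ℝ) ^ 2 * q) :=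
      div_nonneg (Finset.sum_nonneg fun l _ => mul_nonneg (hw l) (sq_nonneg _)) (by positivity)
    have h2 := mul_le_mul_of_nonneg_left (norm_le_l1 b) (show 0 ≤ 2 * t by positivity)
    linarith

/-- The sample cross moments `n⁻¹ ∑_i Z_{il} X_{ij}`. -/
noncomputable def crossZX (d : Fin n → Obs p q) (l : Fin q) (j : Fin p) : ℝ :=
  (∑ i, (d i).z l * (d i).x j) / n

/-- The sample cross moments `n⁻¹ ∑_i Z_{il} u_i`. -/
noncomputable def crossZU (d : Fin n → Obs p q) (l : Fin q) : ℝ :=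
  (∑ i, (d i).z l * (d i).u) / n

theorem residual_eq (d : Fin n → Obs p q) (β₀ b : Fin p → ℝ) (i : Fin n) :
    outcomes d β₀ i - (regressors d *ᵥ b) i = (d i).u - ∑ j, (d i).x j * (b - β₀) j := by
  simp only [outcomes, regressors, Matrix.mulVec, dotProduct, Pi.add_apply, Matrix.of_apply,
    Pi.sub_apply, mul_sub, Finset.sum_sub_distrib]
  ring

theorem gmmObjective_outcomes (hn : 0 < n) (d : Fin n → Obs p q) (β₀ : Fin p → ℝ)
    (w : Fin q → ℝ) (t : ℝ) (b : Fin p → ℝ) :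
    gmmObjective (regressors d) (instruments d) (outcomes d β₀) (Matrix.diagonal w) t b =
      (∑ l, w l * (crossZU d l - ∑ j, crossZX d l j * (b - β₀) j) ^ 2) / q + 2 * t * l1 b := by
  have hn' : (n : ℝ) ≠ 0 := by positivity
  rw [gmmObjective_diagonal]
  congr 1
  rw [← div_div, Finset.sum_div]
  congr 1
  refine Finset.sum_congr rfl fun l _ => ?_
  have : ∑ i, instruments d i l * (outcomes d β₀ i - (regressors d *ᵥ b) i) =
      n * (crossZU d l - ∑ j, crossZX d l j * (b - β₀) j) := by
    simp_rw [residual_eq, mul_sub, Finset.sum_sub_distrib, crossZU, crossZX, div_mul_eq_mul_div,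
      ← Finset.sum_div, Finset.mul_sum, Finset.sum_mul]
    rw [Finset.sum_comm (s := Finset.univ (α := Fin p))]
    field_simp
    rfl
  rw [this]
  field_simp

theorem l1_eq_add (S : Finset (Fin p)) (b : Fin p → ℝ) :
    l1 b = ∑ j ∈ S, |b j| + ∑ j ∈ Sᶜ, |b j| :=
  (Finset.sum_add_sum_compl S _).symm

/-- The basic inequality of the Lasso. -/
theorem lasso_basic {G : Fin q → Fin p → ℝ} {g w : Fin q → ℝ} {t : ℝ} {b β₀ : Fin p → ℝ}
    (hmin : (∑ l, w l * (g l - ∑ j, G l j * (b - β₀) j) ^ 2) / q + 2 * t * l1 b ≤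
      (∑ l, w l * g l ^ 2) / q + 2 * t * l1 β₀) (ht : 0 ≤ t)
    (hnoise : ∀ j, |∑ l, w l * G l j * g l| / q ≤ t / 2) {S : Finset (Fin p)}
    (hS : ∀ j ∉ S, β₀ j = 0) :
    (∑ l, w l * (∑ j, G l j * (b - β₀) j) ^ 2) / q + t * l1 (b - β₀) ≤
      4 * t * ∑ j ∈ S, |(b - β₀) j| := by
  set δ := b - β₀ with hδ
  have hexp : ∑ l, w l * (g l - ∑ j, G l j * δ j) ^ 2 =
      ∑ l, w l * g l ^ 2 - 2 * ∑ j, δ j * ∑ l, w l * G l j * g l +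
        ∑ l, w l * (∑ j, G l j * δ j) ^ 2 := by
    have : ∑ j, δ j * ∑ l, w l * G l j * g l = ∑ l, w l * g l * ∑ j, G l j * δ j := by
      simp_rw [Finset.mul_sum]
      rw [Finset.sum_comm]
      refine Finset.sum_congr rfl fun l _ => Finset.sum_congr rfl fun j _ => by ring
    rw [this, Finset.mul_sum, ← Finset.sum_sub_distrib, ← Finset.sum_add_distrib]
    refine Finset.sum_congr rfl fun l _ => by ring
  -- Doubled, the cross term costs t‖δ‖₁, half of what the penalty 2t provides; the other half
  -- remains on the left of the conclusion.
  have hcross : (∑ j, δ j * ∑ l, w l * G l j * g l) / q ≤ t / 2 * l1 δ := by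
    rw [Finset.sum_div, l1, Finset.mul_sum]
    refine Finset.sum_le_sum fun j _ => ?_
    rw [mul_div_assoc]
    refine (le_abs_self _).trans ?_
    rw [abs_mul, abs_div, Nat.abs_cast, mul_comm]
    exact mul_le_mul_of_nonneg_right (hnoise j) (abs_nonneg _)
  rw [hexp, add_div, sub_div, mul_div_assoc] at hmin
  have h1 : l1 β₀ - l1 b ≤ ∑ j ∈ S, |δ j| - ∑ j ∈ Sᶜ, |δ j| := by
    rw [l1_eq_add S β₀, l1_eq_add S b]
    have e1 : ∑ j ∈ Sᶜ, |β₀ j| = 0 := Finset.sum_eq_zero fun j hj => by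
      rw [hS j (Finset.mem_compl.1 hj), abs_zero]
    have e2 : ∑ j ∈ Sᶜ, |b j| = ∑ j ∈ Sᶜ, |δ j| := Finset.sum_congr rfl fun j hj => by
      rw [hδ, Pi.sub_apply, hS j (Finset.mem_compl.1 hj), sub_zero]
    have e3 : ∑ j ∈ S, |β₀ j| - ∑ j ∈ S, |b j| ≤ ∑ j ∈ S, |δ j| := by
      rw [← Finset.sum_sub_distrib]
      refine Finset.sum_le_sum fun j _ => ?_
      rw [hδ, Pi.sub_apply, abs_sub_comm]
      exact abs_sub_abs_le_abs_sub _ _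
    linarith
  have h2 := mul_le_mul_of_nonneg_left h1 (show 0 ≤ 2 * t by positivity)
  have h3 := l1_eq_add S δ
  nlinarith

theorem sum_abs_le_sqrt {s : ℕ} {S : Finset (Fin p)} (hS : S.card ≤ s) (δ : Fin p → ℝ) :
    ∑ j ∈ S, |δ j| ≤ √(s : ℝ) * √(∑ j ∈ S, δ j ^ 2) := by
  rw [← Real.sqrt_mul (by positivity)]
  refine Real.le_sqrt_of_sq_le ?_
  refine (sq_sum_le_card_mul_sum_sq (s := S) (f := fun j => |δ j|)).trans ?_
  simp_rw [sq_abs]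
  gcongr

/-- The `ℓ₁`-rate that the basic inequality and a restricted eigenvalue bound give. -/
theorem l1_le_of_restricted_eigenvalue {δ : Fin p → ℝ} {S : Finset (Fin p)} {s : ℕ}
    {t κ Q : ℝ} (hS : S.card ≤ s) (ht : 0 < t) (hκ : 0 < κ) (hQ : 0 ≤ Q)
    (hbasic : Q + t * l1 δ ≤ 4 * t * ∑ j ∈ S, |δ j|)
    (hre : ∑ j ∈ Sᶜ, |δ j| ≤ 3 * √(s : ℝ) * √(∑ j ∈ S, δ j ^ 2) →
      κ * ∑ j ∈ S, δ j ^ 2 ≤ Q) :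
    l1 δ ≤ 4 * t * s / κ := by
  have h1 := sum_abs_le_sqrt hS δ
  set a := √(s : ℝ)
  set D := √(∑ j ∈ S, δ j ^ 2)
  have hcone : ∑ j ∈ Sᶜ, |δ j| ≤ 3 * a * D := by
    have h2 := l1_eq_add S δ
    have h3 : t * l1 δ ≤ t * (4 * ∑ j ∈ S, |δ j|) := by linarith
    have h4 := le_of_mul_le_mul_left h3 ht
    linarith
  have hre := hre hcone
  have hD : D ^ 2 = ∑ j ∈ S, δ j ^ 2 := Real.sq_sqrt (Finset.sum_nonneg fun j _ => sq_nonneg _)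
  have ha : a ^ 2 = s := Real.sq_sqrt (Nat.cast_nonneg s)
  rw [← hD] at hre
  rw [le_div_iff₀ hκ]
  have h5 : t * l1 δ ≤ 4 * t * (a * D) - κ * D ^ 2 := by
    have := mul_le_mul_of_nonneg_left h1 (show 0 ≤ 4 * t by positivity)
    linarith
  -- With D = ‖δ_S‖₂, completing the square bounds 4t√s·D − κD² by 4t²s/κ, whatever D is.
  have h6 : t * (l1 δ * κ) ≤ t * (4 * t * s) := by
    have := mul_le_mul_of_nonneg_right h5 hκ.le
    rw [← ha]
    nlinarith [sq_nonneg (2 * t * a - κ * D)]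
  exact le_of_mul_le_mul_left h6 ht

theorem l1_le_of_cone {δ : Fin p → ℝ} {S : Finset (Fin p)} {s : ℕ} (hS : S.card ≤ s)
    (hcone : ∑ j ∈ Sᶜ, |δ j| ≤ 3 * √(s : ℝ) * √(∑ j ∈ S, δ j ^ 2)) :
    l1 δ ^ 2 ≤ 16 * s * ∑ j ∈ S, δ j ^ 2 := by
  have h1 := sum_abs_le_sqrt hS δ
  have h2 : l1 δ ≤ 4 * (√(s : ℝ) * √(∑ j ∈ S, δ j ^ 2)) := by
    rw [l1_eq_add S]; linarith
  have h3 : 0 ≤ l1 δ := Finset.sum_nonneg fun j _ => abs_nonneg _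
  refine (pow_le_pow_left₀ h3 h2 2).trans (le_of_eq ?_)
  rw [mul_pow, mul_pow, Real.sq_sqrt (Nat.cast_nonneg s),
    Real.sq_sqrt (Finset.sum_nonneg fun j _ => sq_nonneg _)]
  ring

/-- The infimum is over a set bounded below by 0, hence below each quotient. If δ_S = 0 the claim is
the nonnegativity of the quadratic form, so δ ≠ 0 need not be assumed. -/
theorem phiSq_mul_le (P : Measure (Obs p q)) (hσ : ∀ l, 0 ≤ sigmaSq P l) (hq : 0 < q)
    {δ : Fin p → ℝ} {S : Finset (Fin p)} {s : ℕ} (hS : S.card ≤ s)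
    (hcone : ∑ j ∈ Sᶜ, |δ j| ≤ 3 * √(s : ℝ) * √(∑ j ∈ S, δ j ^ 2)) :
    phiSq P s * ∑ j ∈ S, δ j ^ 2 ≤
      (∑ l, 1 / sigmaSq P l * (∑ j, SigmaXZ P j l * δ j) ^ 2) / q := by
  have hquad : ∀ δ' : Fin p → ℝ, δ' ⬝ᵥ ((SigmaXZ P * Wd P * (SigmaXZ P)ᵀ) *ᵥ δ') =
      ∑ l, 1 / sigmaSq P l * (∑ j, SigmaXZ P j l * δ' j) ^ 2 := fun δ' =>
    dotProduct_mul_diagonal_mulVec _ _ _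
  have hquad0 : ∀ δ' : Fin p → ℝ,
      0 ≤ ∑ l, 1 / sigmaSq P l * (∑ j, SigmaXZ P j l * δ' j) ^ 2 := fun δ' =>
    Finset.sum_nonneg fun l _ => mul_nonneg (one_div_nonneg.2 (hσ l)) (sq_nonneg _)
  rcases (Finset.sum_nonneg fun j (_ : j ∈ S) => sq_nonneg (δ j)).eq_or_lt with h0 | h0
  · rw [← h0, mul_zero]
    exact div_nonneg (hquad0 δ) (Nat.cast_nonneg q)
  · have hδ : δ ≠ 0 := by
      rintro rfl
      simp at h0
    have hle : phiSq P s ≤ (∑ l, 1 / sigmaSq P l * (∑ j, SigmaXZ P j l * δ j) ^ 2) /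
        (q * ∑ j ∈ S, δ j ^ 2) := by
      refine csInf_le ⟨0, ?_⟩ ⟨δ, S, hδ, hS, hcone, by rw [hquad]⟩
      rintro r ⟨δ', S', -, -, -, rfl⟩
      rw [hquad]
      exact div_nonneg (hquad0 δ')
        (mul_nonneg (Nat.cast_nonneg q) (Finset.sum_nonneg fun j _ => sq_nonneg _))
    have hq' : (0 : ℝ) < q := by exact_mod_cast hq
    rw [le_div_iff₀ (by positivity)] at hle ⊢
    linarith

/-- The restricted eigenvalue bound passes from the population to the sample. -/
theorem restricted_eigenvalue_sample (P : Measure (Obs p q)) {c a ε : ℝ} (hc : 0 < c) (ha : 0 ≤ a)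
    (hσ : ∀ l, c ≤ sigmaSq P l) (hq : 0 < q) {w : Fin q → ℝ}
    (hw : ∀ l, a * (1 / sigmaSq P l) ≤ w l) {G : Fin q → Fin p → ℝ}
    (hG : ∀ l j, |G l j - SigmaXZ P j l| ≤ ε) {δ : Fin p → ℝ} {S : Finset (Fin p)} {s : ℕ}
    (hS : S.card ≤ s) (hcone : ∑ j ∈ Sᶜ, |δ j| ≤ 3 * √(s : ℝ) * √(∑ j ∈ S, δ j ^ 2)) :
    a * (phiSq P s / 2 - 16 * s * ε ^ 2 / c) * ∑ j ∈ S, δ j ^ 2 ≤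
      (∑ l, w l * (∑ j, G l j * δ j) ^ 2) / q := by
  have hq' : (0 : ℝ) < q := by exact_mod_cast hq
  have hphi := phiSq_mul_le P (fun l => hc.le.trans (hσ l)) hq hS hcone
  have hl1 := l1_le_of_cone hS hcone
  set D := ∑ j ∈ S, δ j ^ 2
  set A := ∑ l, 1 / sigmaSq P l * (∑ j, SigmaXZ P j l * δ j) ^ 2
  have hdiff : ∀ l, (∑ j, G l j * δ j - ∑ j, SigmaXZ P j l * δ j) ^ 2 ≤ ε ^ 2 * l1 δ ^ 2 := by
    intro l
    rw [← mul_pow, ← sq_abs]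
    refine pow_le_pow_left₀ (abs_nonneg _) ?_ 2
    rw [← Finset.sum_sub_distrib, l1, Finset.mul_sum]
    refine (Finset.abs_sum_le_sum_abs _ _).trans (Finset.sum_le_sum fun j _ => ?_)
    rw [← sub_mul, abs_mul]
    exact mul_le_mul_of_nonneg_right (hG l j) (abs_nonneg _)
  have hterm : ∀ l, a * (1 / 2 * (1 / sigmaSq P l * (∑ j, SigmaXZ P j l * δ j) ^ 2) -
      ε ^ 2 * l1 δ ^ 2 / c) ≤ w l * (∑ j, G l j * δ j) ^ 2 := fun l => by
    have hσl : 0 < sigmaSq P l := hc.trans_le (hσ l)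
    have h1 : 1 / sigmaSq P l * (ε ^ 2 * l1 δ ^ 2) ≤ ε ^ 2 * l1 δ ^ 2 / c := by
      rw [div_mul_eq_mul_div, one_mul]
      exact div_le_div_of_nonneg_left (by positivity) hc (hσ l)
    -- This is y²/2 − (x − y)² ≤ x², equivalent to 0 ≤ (2x − y)².
    have h2 : (∑ j, SigmaXZ P j l * δ j) ^ 2 / 2 - ε ^ 2 * l1 δ ^ 2 ≤ (∑ j, G l j * δ j) ^ 2 := by
      have := hdiff l
      nlinarith [sq_nonneg (2 * (∑ j, G l j * δ j) - ∑ j, SigmaXZ P j l * δ j)]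
    have h3 := mul_le_mul_of_nonneg_left h2 (one_div_pos.2 hσl).le
    calc _ ≤ a * (1 / sigmaSq P l * (∑ j, G l j * δ j) ^ 2) := by
          refine mul_le_mul_of_nonneg_left ?_ ha
          linarith
      _ ≤ _ := by
          rw [← mul_assoc]
          exact mul_le_mul_of_nonneg_right (hw l) (sq_nonneg _)
  have hsum := Finset.sum_le_sum fun l (_ : l ∈ Finset.univ) => hterm l
  rw [← Finset.mul_sum, Finset.sum_sub_distrib, ← Finset.mul_sum] at hsum
  change a * (1 / 2 * A - _) ≤ _ at hsum
  rw [Finset.sum_const, Finset.card_univ, Fintype.card_fin, nsmul_eq_mul] at hsum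
  rw [le_div_iff₀ hq']
  rw [le_div_iff₀ hq'] at hphi
  have h4 : ε ^ 2 * l1 δ ^ 2 / c ≤ 16 * s * ε ^ 2 / c * D := by
    rw [div_mul_eq_mul_div]
    have := mul_le_mul_of_nonneg_left hl1 (sq_nonneg ε)
    exact div_le_div_of_nonneg_right (by linarith) hc.le
  refine le_trans ?_ hsum
  rw [mul_assoc, mul_assoc]
  refine mul_le_mul_of_nonneg_left ?_ ha
  have h5 := mul_le_mul_of_nonneg_left h4 hq'.le
  linarith

end Lasso

/-! ### Deterministic analysis of the two steps on samples with accurate moments -/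

section Deterministic

variable {n p q : ℕ}

/-- All the sample moments that enter the estimators are within `ε` of their expectations. -/
structure MomentsClose (P : Measure (Obs p q)) (d : Fin n → Obs p q) (ε : ℝ) : Prop where
  zu : ∀ l, |∑ i, (d i).z l * (d i).u| ≤ n * ε
  zx : ∀ j l, |∑ i, ((d i).z l * (d i).x j - ∫ o, o.z l * o.x j ∂P)| ≤ n * ε
  zzuu : ∀ l, |∑ i, ((d i).z l ^ 2 * (d i).u ^ 2 - ∫ o, o.z l ^ 2 * o.u ^ 2 ∂P)| ≤ n * ε
  zzux : ∀ j l, |∑ i, ((d i).z l ^ 2 * (d i).u * (d i).x j -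
    ∫ o, o.z l ^ 2 * o.u * o.x j ∂P)| ≤ n * ε
  zzxx : ∀ j k l, |∑ i, ((d i).z l ^ 2 * (d i).x j * (d i).x k -
    ∫ o, o.z l ^ 2 * o.x j * o.x k ∂P)| ≤ n * ε

theorem abs_mean_sub_le (hn : 0 < n) {f : Fin n → ℝ} {e ε : ℝ}
    (h : |∑ i, (f i - e)| ≤ n * ε) : |(∑ i, f i) / n - e| ≤ ε := by
  have hn' : (0 : ℝ) < n := by exact_mod_cast hn
  have : (∑ i, f i) / n - e = (∑ i, (f i - e)) / n := by
    rw [Finset.sum_sub_distrib]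
    simp
    field_simp
  rw [this, abs_div, Nat.abs_cast, div_le_iff₀ hn']
  linarith

theorem abs_mean_le (hn : 0 < n) {f : Fin n → ℝ} {e ε m : ℝ}
    (h : |∑ i, (f i - e)| ≤ n * ε) (he : |e| ≤ m) : |(∑ i, f i) / n| ≤ m + ε := by
  have h1 := abs_mean_sub_le hn h
  have h2 := abs_sub_abs_le_abs_sub ((∑ i, f i) / n) e
  linarith

/-- Since û = u − X'δ, the variance estimate is a quadratic polynomial in δ, with coefficients the
sample moments controlled through M₃, M₄ and M₅. -/
theorem sigmaHatSq_outcomes (d : Fin n → Obs p q) (β₀ b : Fin p → ℝ) (l : Fin q) :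
    sigmaHatSq (regressors d) (instruments d) (outcomes d β₀) b l =
      (∑ i, (d i).z l ^ 2 * (d i).u ^ 2) / n -
        2 * ∑ j, (b - β₀) j * ((∑ i, (d i).z l ^ 2 * (d i).u * (d i).x j) / n) +
        ∑ j, ∑ k, (b - β₀) j * (b - β₀) k *
          ((∑ i, (d i).z l ^ 2 * (d i).x j * (d i).x k) / n) := by
  set δ := b - β₀
  have e1 : ∑ j, δ j * ((∑ i, (d i).z l ^ 2 * (d i).u * (d i).x j) / n) =
      (∑ i, (d i).z l ^ 2 * (d i).u * ∑ j, (d i).x j * δ j) / n := by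
    simp_rw [← mul_div_assoc, Finset.mul_sum, ← Finset.sum_div]
    rw [Finset.sum_comm]
    congr 1
    exact Finset.sum_congr rfl fun i _ => Finset.sum_congr rfl fun j _ => by ring
  have e2 : ∑ j, ∑ k, δ j * δ k * ((∑ i, (d i).z l ^ 2 * (d i).x j * (d i).x k) / n) =
      (∑ i, (d i).z l ^ 2 * (∑ j, (d i).x j * δ j) ^ 2) / n := by
    have h : ∀ i, (d i).z l ^ 2 * (∑ j, (d i).x j * δ j) ^ 2 =
        ∑ j, ∑ k, δ j * δ k * ((d i).z l ^ 2 * (d i).x j * (d i).x k) := fun i => by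
      rw [sq (∑ j, (d i).x j * δ j), Finset.sum_mul_sum, Finset.mul_sum]
      refine Finset.sum_congr rfl fun j _ => ?_
      rw [Finset.mul_sum]
      exact Finset.sum_congr rfl fun k _ => by ring
    simp_rw [h, ← mul_div_assoc, ← Finset.sum_div, Finset.mul_sum]
    congr 1
    conv_rhs => rw [Finset.sum_comm]
    refine Finset.sum_congr rfl fun j _ => ?_
    rw [Finset.sum_comm]
  rw [e1, e2, sigmaHatSq, mul_div_assoc', ← sub_div, ← add_div, Finset.mul_sum,
    ← Finset.sum_sub_distrib, ← Finset.sum_add_distrib]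
  congr 1
  refine Finset.sum_congr rfl fun i _ => ?_
  rw [residual_eq]
  change (d i).z l ^ 2 * _ = _
  ring

theorem abs_sum_mul_le_l1 {δ a : Fin p → ℝ} {m : ℝ} (h : ∀ j, |a j| ≤ m) :
    |∑ j, δ j * a j| ≤ m * l1 δ := by
  rw [l1, Finset.mul_sum]
  refine (Finset.abs_sum_le_sum_abs _ _).trans (Finset.sum_le_sum fun j _ => ?_)
  rw [abs_mul, mul_comm]
  exact mul_le_mul_of_nonneg_right (h j) (abs_nonneg _)

/-- Bounds by `m` on the population cross moments. -/
structure CrossMomentsBounded (P : Measure (Obs p q)) (m : ℝ) : Prop where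
  zx : ∀ j l, |∫ o, o.z l * o.x j ∂P| ≤ m
  zzux : ∀ j l, |∫ o, o.z l ^ 2 * o.u * o.x j ∂P| ≤ m
  zzxx : ∀ j k l, |∫ o, o.z l ^ 2 * o.x j * o.x k ∂P| ≤ m

theorem abs_sigmaHatSq_sub_le (hn : 0 < n) {P : Measure (Obs p q)} {d : Fin n → Obs p q}
    {ε m : ℝ} (hm : CrossMomentsBounded P m) (hd : MomentsClose P d ε) (β₀ b : Fin p → ℝ)
    (l : Fin q) :
    |sigmaHatSq (regressors d) (instruments d) (outcomes d β₀) b l - sigmaSq P l| ≤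
      ε + 2 * ((m + ε) * l1 (b - β₀)) + (m + ε) * l1 (b - β₀) ^ 2 := by
  rw [sigmaHatSq_outcomes]
  set δ := b - β₀
  have h0 : |(∑ i, (d i).z l ^ 2 * (d i).u ^ 2) / n - sigmaSq P l| ≤ ε :=
    abs_mean_sub_le hn (hd.zzuu l)
  have h1 : |∑ j, δ j * ((∑ i, (d i).z l ^ 2 * (d i).u * (d i).x j) / n)| ≤ (m + ε) * l1 δ :=
    abs_sum_mul_le_l1 fun j => abs_mean_le hn (hd.zzux j l) (hm.zzux j l)
  have h2 : |∑ j, ∑ k, δ j * δ k * ((∑ i, (d i).z l ^ 2 * (d i).x j * (d i).x k) / n)| ≤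
      (m + ε) * l1 δ ^ 2 := by
    simp_rw [mul_assoc (δ _), ← Finset.mul_sum]
    rw [sq, ← mul_assoc]
    exact abs_sum_mul_le_l1 fun j => abs_sum_mul_le_l1 fun k =>
      abs_mean_le hn (hd.zzxx j k l) (hm.zzxx j k l)
  rw [abs_le] at *
  constructor <;> linarith [h0.1, h0.2, h1.1, h1.2, h2.1, h2.2]

theorem abs_noise_div_le (hn : 0 < n) (hq : 0 < q) {P : Measure (Obs p q)} {d : Fin n → Obs p q}
    {ε m v : ℝ} (hm : CrossMomentsBounded P m) (hd : MomentsClose P d ε) {w : Fin q → ℝ}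
    (hw0 : ∀ l, 0 ≤ w l) (hw : ∀ l, w l ≤ v) (j : Fin p) :
    |∑ l, w l * crossZX d l j * crossZU d l| / q ≤ v * ((m + ε) * ε) := by
  have hq' : (0 : ℝ) < q := by exact_mod_cast hq
  have hn' : (0 : ℝ) < n := by exact_mod_cast hn
  have hzx : ∀ l, |crossZX d l j| ≤ m + ε := fun l => abs_mean_le hn (hd.zx j l) (hm.zx j l)
  have hzu : ∀ l, |crossZU d l| ≤ ε := fun l => by
    rw [crossZU, abs_div, Nat.abs_cast, div_le_iff₀ hn']
    linarith [hd.zu l]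
  rw [div_le_iff₀ hq']
  calc _ ≤ ∑ l, |w l * crossZX d l j * crossZU d l| := Finset.abs_sum_le_sum_abs _ _
    _ ≤ ∑ _l : Fin q, v * ((m + ε) * ε) := Finset.sum_le_sum fun l _ => by
        rw [abs_mul, abs_mul, abs_of_nonneg (hw0 l), mul_assoc]
        have h1 := hzx l
        have h2 := hzu l
        have h3 := (abs_nonneg _).trans h1
        exact mul_le_mul (hw l) (mul_le_mul h1 h2 (abs_nonneg _) h3) (by positivity)
          ((hw0 l).trans (hw l))
    _ = _ := by simp; ring

/-- A Lasso GMM estimate with a diagonal weight matrix is close to `β₀` when the sample moments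
are close to their expectations. -/
theorem l1_sub_le_of_minimiser (hn : 0 < n) (hq : 0 < q) {P : Measure (Obs p q)}
    {d : Fin n → Obs p q} {s : ℕ} {c ε m a t v : ℝ} (hc : 0 < c) (ha : 0 < a) (ht : 0 < t)
    (hφ : c ≤ phiSq P s) (hσ : ∀ l, c ≤ sigmaSq P l)
    (hm : CrossMomentsBounded P m) (hd : MomentsClose P d ε) (hs : 96 * s * ε ^ 2 ≤ c ^ 2)
    {w : Fin q → ℝ} (hw : ∀ l, a * (1 / sigmaSq P l) ≤ w l) (hwv : ∀ l, w l ≤ v)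
    (hv : v * ((m + ε) * ε) ≤ t / 2) {β₀ b : Fin p → ℝ} (hβ : l0 β₀ ≤ s)
    (hb : gmmObjective (regressors d) (instruments d) (outcomes d β₀) (Matrix.diagonal w) t b ≤
      gmmObjective (regressors d) (instruments d) (outcomes d β₀) (Matrix.diagonal w) t β₀) :
    l1 (b - β₀) ≤ 4 * t * s / (a * (phiSq P s / 3)) := by
  classical
  have hw0 : ∀ l, 0 ≤ w l := fun l =>
    (mul_nonneg ha.le (one_div_nonneg.2 (hc.le.trans (hσ l)))).trans (hw l)
  set S : Finset (Fin p) := Finset.univ.filter fun j => β₀ j ≠ 0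
  have hS : S.card ≤ s := by
    have : l0 β₀ = S.card := by
      rw [l0, Set.ncard_eq_toFinset_card']
      congr 1
      ext j
      simp [S]
    omega
  rw [gmmObjective_outcomes hn, gmmObjective_outcomes hn] at hb
  simp only [sub_self, Pi.zero_apply, mul_zero, Finset.sum_const_zero, sub_zero] at hb
  have hbasic := lasso_basic (S := S) hb ht.le
    (fun j => (abs_noise_div_le hn hq hm hd hw0 hwv j).trans hv) (fun j hj => by simpa [S] using hj)
  refine l1_le_of_restricted_eigenvalue hS ht (by have := hc.trans_le hφ; positivity)
    (div_nonneg (Finset.sum_nonneg fun l _ => mul_nonneg (hw0 l) (sq_nonneg _)) (by positivity))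
    hbasic fun hcone => ?_
  refine le_trans ?_ (restricted_eigenvalue_sample P hc ha.le hσ hq hw (G := crossZX d)
    (ε := ε) (fun l j => ?_) hS hcone)
  · refine mul_le_mul_of_nonneg_right ?_ (Finset.sum_nonneg fun j _ => sq_nonneg _)
    refine mul_le_mul_of_nonneg_left ?_ ha.le
    -- The constant 96 = 16 · 6 limits the sampling loss to φ²/6, which leaves φ²/2 − φ²/6 = φ²/3.
    have : 16 * s * ε ^ 2 / c ≤ phiSq P s / 6 := by
      rw [div_le_iff₀ hc]
      nlinarith
    linarith
  · have := abs_mean_sub_le hn (hd.zx j l)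
    simpa only [crossZX, SigmaXZ, Matrix.of_apply, mul_comm] using this

/-- The oracle inequality for the two-step Lasso GMM estimator, on samples whose moments are close
to their expectations. -/
theorem twoStep_oracle (hn : 0 < n) (hq : 0 < q) {P : Measure (Obs p q)}
    {d : Fin n → Obs p q} {s : ℕ} {c ε m t r : ℝ} (hc : 0 < c) (hε : 0 < ε)
    (hφ : c ≤ phiSq P s) (hσ : ∀ l, c ≤ sigmaSq P l)
    (hm : CrossMomentsBounded P m) (hm0 : 0 ≤ m) (hd : MomentsClose P d ε)
    (hs : 96 * s * ε ^ 2 ≤ c ^ 2) (ht : 2 * ((m + ε) * ε) ≤ t) (hr : 12 * t * s / c ^ 2 ≤ r)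
    (hsmall : ε + 2 * ((m + ε) * r) + (m + ε) * r ^ 2 ≤ c / 2)
    {β₀ : Fin p → ℝ} (hβ : l0 β₀ ≤ s) :
    let X := regressors d
    let Z := instruments d
    let Y := outcomes d β₀
    let t' := t * (2 / ⨅ l, sigmaSq P l)
    (∃ bF, IsFirstStep X Z Y t bF) ∧
    ∀ bF, IsFirstStep X Z Y t bF →
      (∀ l, 0 < sigmaHatSq X Z Y bF l) ∧
      (∃ b, IsTwoStep X Z Y bF t' b) ∧
      ∀ b, IsTwoStep X Z Y bF t' b → l1 (b - β₀) ≤ 24 * t' * s / phiSq P s := by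
  intro X Z Y t'
  have ht0 : 0 < t := lt_of_lt_of_le (by positivity) ht
  have : Nonempty (Fin q) := ⟨⟨0, hq⟩⟩
  have hσpos : ∀ l, 0 < sigmaSq P l := fun l => hc.trans_le (hσ l)
  have hinf : 0 < ⨅ l, sigmaSq P l := hc.trans_le (le_ciInf hσ)
  have hinf_le : ∀ l, ⨅ l, sigmaSq P l ≤ sigmaSq P l := fun l =>
    ciInf_le (Set.finite_range _).bddBelow l
  have ht'0 : 0 < t' := by positivity
  have hfirst : ∀ b, IsFirstStep X Z Y t b ↔ ∀ b', gmmObjective X Z Y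
      (Matrix.diagonal fun _ => 1) t b ≤ gmmObjective X Z Y (Matrix.diagonal fun _ => 1) t b' :=
    fun b => by rw [Matrix.diagonal_one]; rfl
  simp_rw [hfirst]
  refine ⟨exists_gmmObjective_minimiser X Z Y (fun _ => zero_le_one) ht0, fun bF hbF => ?_⟩
  have hL : l1 (bF - β₀) ≤ r := by
    -- Identity weights dominate c·W_d because σ_l² ≥ c; the resulting rate 12ts/(cφ²) is at most
    -- 12ts/c² ≤ r.
    refine (l1_sub_le_of_minimiser (a := c) (v := 1) hn hq hc hc ht0 hφ hσ hm hd hs (fun l => ?_)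
      (fun _ => le_rfl) (by linarith) hβ (hbF β₀)).trans (le_trans ?_ hr)
    · rw [mul_one_div]
      exact div_le_one_of_le₀ (hσ l) (hσpos l).le
    · have h1 : c ^ 2 ≤ c * phiSq P s := by nlinarith
      calc 4 * t * s / (c * (phiSq P s / 3)) = 12 * t * s / (c * phiSq P s) := by
            field_simp; ring
        _ ≤ _ := by gcongr
  have hL0 : 0 ≤ l1 (bF - β₀) := Finset.sum_nonneg fun j _ => abs_nonneg _
  have hhat : ∀ l, |sigmaHatSq X Z Y bF l - sigmaSq P l| ≤ c / 2 := fun l => by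
    refine (abs_sigmaHatSq_sub_le hn hm hd β₀ bF l).trans (le_trans ?_ hsmall)
    gcongr
  have hlow : ∀ l, sigmaSq P l / 2 ≤ sigmaHatSq X Z Y bF l := fun l => by
    linarith [(abs_le.1 (hhat l)).1, hσ l]
  have hup : ∀ l, sigmaHatSq X Z Y bF l ≤ 2 * sigmaSq P l := fun l => by
    linarith [(abs_le.1 (hhat l)).2, hσ l]
  have hpos : ∀ l, 0 < sigmaHatSq X Z Y bF l := fun l =>
    lt_of_lt_of_le (half_pos (hσpos l)) (hlow l)
  refine ⟨hpos, exists_gmmObjective_minimiser X Z Y (fun l => (one_div_pos.2 (hpos l)).le) ht'0,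
    fun b hb => ?_⟩
  -- From σ̂² ≤ 2σ² the weights are at least W_d/2, which turns the factor 12 into 24. From σ̂² ≥
  -- σ²/2 they are at most 2/min σ², the factor by which the second tuning parameter exceeds the
  -- first.
  have := l1_sub_le_of_minimiser (a := 1 / 2) (v := 2 / ⨅ l, sigmaSq P l) hn hq hc (by norm_num)
    ht'0 hφ hσ hm hd hs (w := fun l => 1 / sigmaHatSq X Z Y bF l) (fun l => ?_) (fun l => ?_) ?_ hβ
    (hb β₀)
  · refine this.trans (le_of_eq ?_)
    field_simp
    ring
  · rw [one_div_mul_one_div]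
    exact one_div_le_one_div_of_le (hpos l) (hup l)
  · rw [div_le_div_iff₀ (hpos l) hinf]
    linarith [hinf_le l, hlow l]
  · have h1 : (m + ε) * ε ≤ t / 2 := by linarith
    have h2 := mul_le_mul_of_nonneg_left h1 (show 0 ≤ 2 / ⨅ l, sigmaSq P l by positivity)
    calc _ ≤ _ := h2
      _ = t' / 2 := by simp only [t']; ring

end Deterministic

/-! ### Second moments from the moment conditions -/

section Moments

variable {n p q : ℕ}

@[fun_prop]
theorem Obs.measurable_x (j : Fin p) : Measurable fun o : Obs p q => o.x j :=
  (measurable_pi_apply j).comp measurable_fst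

@[fun_prop]
theorem Obs.measurable_z (l : Fin q) : Measurable fun o : Obs p q => o.z l :=
  (measurable_pi_apply l).comp (measurable_fst.comp measurable_snd)

@[fun_prop]
theorem Obs.measurable_u : Measurable fun o : Obs p q => o.u :=
  measurable_snd.comp measurable_snd

theorem abs_pow_le_one_add_rpow {k : ℕ} {r : ℝ} (hk : (k : ℝ) ≤ r) (y : ℝ) :
    |y| ^ k ≤ 1 + |y| ^ r := by
  rcases le_total |y| 1 with h | h
  · linarith [pow_le_one₀ (n := k) (abs_nonneg y) h, Real.rpow_nonneg (abs_nonneg y) r]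
  · have := Real.rpow_le_rpow_of_exponent_le h hk
    rw [Real.rpow_natCast] at this
    linarith

theorem integral_abs_pow_le {E : Type*} [MeasurableSpace E] {P : Measure E}
    [IsProbabilityMeasure P] {f : E → ℝ} (hf : Measurable f) {k : ℕ} {r B : ℝ}
    (hk : (k : ℝ) ≤ r) (hint : Integrable (fun o => |f o| ^ r) P) (hB : ∫ o, |f o| ^ r ∂P ≤ B) :
    Integrable (fun o => |f o| ^ k) P ∧ ∫ o, |f o| ^ k ∂P ≤ 1 + |B| := by
  have h1 : Integrable (fun o => 1 + |f o| ^ r) P := (integrable_const _).add hint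
  have h2 : Integrable (fun o => |f o| ^ k) P :=
    h1.mono' (by fun_prop) (Eventually.of_forall fun o => by
      rw [Real.norm_of_nonneg (by positivity)]
      exact abs_pow_le_one_add_rpow hk _)
  refine ⟨h2, (integral_mono h2 h1 fun o => abs_pow_le_one_add_rpow hk _).trans ?_⟩
  rw [integral_add (integrable_const _) hint]
  simp only [integral_const, probReal_univ, smul_eq_mul, one_mul]
  linarith [le_abs_self B]

/-- The second moments of the functions `f` under `P` exist and are at most `V`. -/
def SecondMomentLE {E : Type*} [MeasurableSpace E] (P : Measure E) (V : ℝ) (f : E → ℝ) : Prop :=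
  Measurable f ∧ Integrable (fun o => f o ^ 2) P ∧ ∫ o, f o ^ 2 ∂P ≤ V

theorem SecondMomentLE.of_le {E : Type*} [MeasurableSpace E] {P : Measure E}
    [IsProbabilityMeasure P] {f a b c : E → ℝ} {K : ℝ} (hf : Measurable f) (hK : 1 ≤ K)
    (ha : Integrable a P ∧ ∫ o, a o ∂P ≤ K) (hb : Integrable b P ∧ ∫ o, b o ∂P ≤ K)
    (hc : Integrable c P ∧ ∫ o, c o ∂P ≤ K) (h : ∀ o, f o ^ 2 ≤ 1 + a o + b o + c o) :
    SecondMomentLE P (4 * K) f := by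
  have h1 : Integrable (fun o => 1 + a o) P := (integrable_const _).add ha.1
  have h2 : Integrable (fun o => 1 + a o + b o) P := h1.add hb.1
  have h3 : Integrable (fun o => 1 + a o + b o + c o) P := h2.add hc.1
  have h4 : Integrable (fun o => f o ^ 2) P :=
    h3.mono' (by fun_prop) (Eventually.of_forall fun o => by
      rw [Real.norm_of_nonneg (sq_nonneg _)]
      exact h o)
  refine ⟨hf, h4, (integral_mono h4 h3 h).trans ?_⟩
  rw [integral_add h2 hc.1, integral_add h1 hb.1, integral_add (integrable_const _) ha.1]
  simp only [integral_const, probReal_univ, smul_eq_mul, one_mul]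
  linarith [ha.2, hb.2, hc.2]

theorem SecondMomentLE.integrable {E : Type*} [MeasurableSpace E] {P : Measure E}
    [IsProbabilityMeasure P] {f : E → ℝ} {V : ℝ} (h : SecondMomentLE P V f) : Integrable f P :=
  integrable_of_sq h.1.aestronglyMeasurable h.2.1

theorem SecondMomentLE.abs_integral_le {E : Type*} [MeasurableSpace E] {P : Measure E}
    [IsProbabilityMeasure P] {f : E → ℝ} {V : ℝ} (h : SecondMomentLE P V f) :
    |∫ o, f o ∂P| ≤ 1 + V := by
  have h1 : Integrable (fun o => 1 + f o ^ 2) P := (integrable_const _).add h.2.1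
  refine abs_integral_le_integral_abs.trans ((integral_mono h.integrable.abs h1 fun o => ?_).trans ?_)
  · change |f o| ≤ 1 + f o ^ 2
    rw [← sq_abs]
    nlinarith [sq_nonneg (|f o| - 1), abs_nonneg (f o)]
  · rw [integral_add (integrable_const _) h.2.1]
    simp only [integral_const, probReal_univ, smul_eq_mul, one_mul]
    linarith [h.2.2]

theorem SecondMomentLE.centre {E : Type*} [MeasurableSpace E] {P : Measure E}
    [IsProbabilityMeasure P] {f : E → ℝ} {V : ℝ} (h : SecondMomentLE P V f) :
    SecondMomentLE P V (fun o => f o - ∫ o, f o ∂P) ∧ ∫ o, (f o - ∫ o, f o ∂P) ∂P = 0 := by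
  set e := ∫ o, f o ∂P with he
  have h1 : Integrable (fun o => 2 * e * f o) P := h.integrable.const_mul _
  have h2 : Integrable (fun o => f o ^ 2 - 2 * e * f o) P := h.2.1.sub h1
  have h3 : ∀ o, (f o - e) ^ 2 = f o ^ 2 - 2 * e * f o + e ^ 2 := fun o => by ring
  refine ⟨⟨h.1.sub_const _, ?_, ?_⟩, ?_⟩
  · simp_rw [h3]
    exact h2.add (integrable_const _)
  · simp_rw [h3]
    rw [integral_add h2 (integrable_const _), integral_sub h.2.1 h1, integral_const_mul, ← he]
    simp only [integral_const, probReal_univ, smul_eq_mul, one_mul]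
    nlinarith [h.2.2, sq_nonneg e]
  · rw [integral_sub h.integrable (integrable_const _)]
    simp [he]

theorem three_mul_le_cubes {a b c : ℝ} (ha : 0 ≤ a) (hb : 0 ≤ b) (hc : 0 ≤ c) :
    3 * (a * b * c) ≤ a ^ 3 + b ^ 3 + c ^ 3 := by
  nlinarith [mul_nonneg (add_nonneg (add_nonneg ha hb) hc)
    (add_nonneg (add_nonneg (sq_nonneg (a - b)) (sq_nonneg (b - c))) (sq_nonneg (c - a)))]

section Population

variable {P : Measure (Obs p q)} [IsProbabilityMeasure P] {rx rz ru B c : ℝ} {s : ℕ}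

theorem abs_pow_twelve (z : ℝ) : |z| ^ 12 = (z ^ 4) ^ 3 := by
  rw [Even.pow_abs (n := 12) ⟨6, rfl⟩ z]; ring

theorem abs_pow_six (a : ℝ) : |a| ^ 6 = (a ^ 2) ^ 3 := by
  rw [Even.pow_abs (n := 6) ⟨3, rfl⟩ a]; ring

/-- The square is z⁴a²b², and the arithmetic-geometric mean inequality for three factors yields z¹²,
a⁶, b⁶: the exponents 12, 6, 6 of the moment assumption. -/
theorem sq_mul_mul_sq_le (z a b : ℝ) :
    (z ^ 2 * a * b) ^ 2 ≤ 1 + |z| ^ 12 + |a| ^ 6 + |b| ^ 6 := by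
  have h := three_mul_le_cubes (a := z ^ 4) (b := a ^ 2) (c := b ^ 2) (by positivity)
    (by positivity) (by positivity)
  have e : (z ^ 2 * a * b) ^ 2 = z ^ 4 * a ^ 2 * b ^ 2 := by ring
  rw [abs_pow_twelve, abs_pow_six, abs_pow_six, e]
  have : 0 ≤ z ^ 4 * a ^ 2 * b ^ 2 := by positivity
  linarith

/-- Here x ≤ 1 + x² is applied to x = (za)², and (za)⁴ = z⁴a²a² is treated by the same three-factor
inequality. -/
theorem mul_sq_le (z a : ℝ) : (z * a) ^ 2 ≤ 1 + |z| ^ 12 + |a| ^ 6 + |a| ^ 6 := by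
  have h := three_mul_le_cubes (a := z ^ 4) (b := a ^ 2) (c := a ^ 2) (by positivity)
    (by positivity) (by positivity)
  have e : ((z * a) ^ 2) ^ 2 = z ^ 4 * a ^ 2 * a ^ 2 := by ring
  have h1 : (z * a) ^ 2 ≤ 1 + ((z * a) ^ 2) ^ 2 := by
    nlinarith [sq_nonneg ((z * a) ^ 2 - 1), sq_nonneg (z * a)]
  have h2 : 0 ≤ z ^ 4 * a ^ 2 * a ^ 2 := by positivity
  rw [abs_pow_twelve, abs_pow_six]
  linarith

variable (h : MomentCondition P rx rz ru B c s) (hrx : 6 ≤ rx) (hrz : 12 ≤ rz) (hru : 6 ≤ ru)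

include h

include hrz in
theorem MomentCondition.z12 (l : Fin q) :
    Integrable (fun o => |o.z l| ^ 12) P ∧ ∫ o, |o.z l| ^ 12 ∂P ≤ 1 + |B| :=
  integral_abs_pow_le (Obs.measurable_z l) (by exact_mod_cast hrz) (h.integrable_z l) (h.moment_z l)

include hrx in
theorem MomentCondition.x6 (j : Fin p) :
    Integrable (fun o => |o.x j| ^ 6) P ∧ ∫ o, |o.x j| ^ 6 ∂P ≤ 1 + |B| :=
  integral_abs_pow_le (Obs.measurable_x j) (by exact_mod_cast hrx) (h.integrable_x j) (h.moment_x j)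

include hru in
theorem MomentCondition.u6 :
    Integrable (fun o => |o.u| ^ 6) P ∧ ∫ o, |o.u| ^ 6 ∂P ≤ 1 + |B| :=
  integral_abs_pow_le Obs.measurable_u (by exact_mod_cast hru) h.integrable_u h.moment_u

include hrz hru in
theorem MomentCondition.zu (l : Fin q) :
    SecondMomentLE P (4 * (1 + |B|)) fun o => o.z l * o.u :=
  .of_le (by fun_prop) (by linarith [abs_nonneg B]) (h.z12 hrz l) (h.u6 hru) (h.u6 hru)
    fun o => mul_sq_le _ _

include hrz hrx in
theorem MomentCondition.zx (j : Fin p) (l : Fin q) :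
    SecondMomentLE P (4 * (1 + |B|)) fun o => o.z l * o.x j :=
  .of_le (by fun_prop) (by linarith [abs_nonneg B]) (h.z12 hrz l) (h.x6 hrx j) (h.x6 hrx j)
    fun o => mul_sq_le _ _

include hrz hru in
theorem MomentCondition.zzuu (l : Fin q) :
    SecondMomentLE P (4 * (1 + |B|)) fun o => o.z l ^ 2 * o.u ^ 2 :=
  .of_le (by fun_prop) (by linarith [abs_nonneg B]) (h.z12 hrz l) (h.u6 hru) (h.u6 hru)
    fun o => by
      rw [sq o.u, ← mul_assoc]
      exact sq_mul_mul_sq_le _ _ _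

include hrz hrx hru in
theorem MomentCondition.zzux (j : Fin p) (l : Fin q) :
    SecondMomentLE P (4 * (1 + |B|)) fun o => o.z l ^ 2 * o.u * o.x j :=
  .of_le (by fun_prop) (by linarith [abs_nonneg B]) (h.z12 hrz l) (h.u6 hru) (h.x6 hrx j)
    fun o => sq_mul_mul_sq_le _ _ _

include hrz hrx in
theorem MomentCondition.zzxx (j k : Fin p) (l : Fin q) :
    SecondMomentLE P (4 * (1 + |B|)) fun o => o.z l ^ 2 * o.x j * o.x k :=
  .of_le (by fun_prop) (by linarith [abs_nonneg B]) (h.z12 hrz l) (h.x6 hrx j) (h.x6 hrx k)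
    fun o => sq_mul_mul_sq_le _ _ _

include hrz hrx hru in
theorem MomentCondition.crossMomentsBounded : CrossMomentsBounded P (1 + 4 * (1 + |B|)) where
  zx j l := (h.zx hrx hrz j l).abs_integral_le
  zzux j l := (h.zzux hrx hrz hru j l).abs_integral_le
  zzxx j k l := (h.zzxx hrx hrz j k l).abs_integral_le

end Population

/-! ### Deviations of i.i.d. sample sums -/

section Sample

variable {Ω : Type*} [MeasurableSpace Ω] {μ : Measure Ω} [IsProbabilityMeasure μ]
  {P : Measure (Obs p q)} {D : Fin n → Ω → Obs p q}

theorem IsIIDSample.isProbabilityMeasure (hD : IsIIDSample μ P D) (hn : 0 < n) :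
    IsProbabilityMeasure P := by
  rw [← hD.law ⟨0, hn⟩]
  exact Measure.isProbabilityMeasure_map (hD.measurable _).aemeasurable

omit [IsProbabilityMeasure μ] in
theorem IsIIDSample.integral_comp (hD : IsIIDSample μ P D) {f : Obs p q → ℝ} (hf : Measurable f)
    (i : Fin n) : ∫ ω, f (D i ω) ∂μ = ∫ o, f o ∂P := by
  rw [← hD.law i, integral_map (hD.measurable i).aemeasurable hf.aestronglyMeasurable]

omit [IsProbabilityMeasure μ] in
theorem IsIIDSample.integrable_comp (hD : IsIIDSample μ P D) {f : Obs p q → ℝ}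
    (hf : Integrable f P) (i : Fin n) : Integrable (fun ω => f (D i ω)) μ := by
  rw [← hD.law i] at hf
  exact hf.comp_measurable (hD.measurable i)

omit [IsProbabilityMeasure μ] in
theorem IsIIDSample.integrable_abs_sq (hD : IsIIDSample μ P D) {f : Obs p q → ℝ} {V : ℝ}
    (hf : SecondMomentLE P V f) (i : Fin n) : Integrable (fun ω => |f (D i ω)| ^ 2) μ := by
  simp_rw [sq_abs]
  exact hD.integrable_comp hf.2.1 i

/-- The maximal inequality at ρ = √(log q / n), where nρ² = log q makes the exponential a power of q
and (nρ)² = n log q gives the polynomial term. The cube allows for the largest family, indexed by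
(j, k, l). -/
theorem IsIIDSample.measureReal_exists_lt_le (hD : IsIIDSample μ P D) (hn : 0 < n)
    {ι : Type*} [Fintype ι] {f : ι → Obs p q → ℝ} {V C ρ : ℝ} {M : Ω → ℝ}
    (hf : ∀ j, SecondMomentLE P V (f j)) (hf0 : ∀ j, ∫ o, f j o ∂P = 0)
    (hfM : ∀ ω i j, |f j (D i ω)| ≤ M ω) (hM0 : ∀ ω, 0 ≤ M ω)
    (hM : Integrable (fun ω => M ω ^ 2) μ)
    (hq : 2 ≤ q) (hι : Fintype.card ι ≤ q ^ 3) (hρ : 0 < ρ) (hρn : n * ρ ^ 2 = Real.log q)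
    (h4 : 4 * ρ ^ 2 * ∫ ω, M ω ^ 2 ∂μ ≤ 1) (hC : V + 6 ≤ C) :
    μ.real {ω | ∀ j, |∑ i, f j (D i ω)| ≤ n * (2 * C * ρ)}ᶜ ≤
      2 / (q : ℝ) ^ C + 2 * (∫ ω, M ω ^ 2 ∂μ) / (n * Real.log q) := by
  have hn' : (0 : ℝ) < n := by exact_mod_cast hn
  have hq' : (2 : ℝ) ≤ q := by exact_mod_cast hq
  have hq0 : (0 : ℝ) < q := by linarith
  have hlog : 0.69 < Real.log q :=
    lt_of_lt_of_le (by linarith [Real.log_two_gt_d9]) (Real.log_le_log two_pos hq')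
  -- The value a = 2C − 1 makes the threshold (a + 1)nρ equal to n(2Cρ).
  have hmax := measureReal_exists_lt_abs_sum_le (μ := μ) hn (ξ := fun i ω j => f j (D i ω)) (M := M)
    (V := V) (ρ := ρ) (fun i => measurable_pi_lambda _ fun j => (hf j).1.comp (hD.measurable i))
    (hD.indep.comp (fun _ o j => f j o) fun _ => measurable_pi_lambda _ fun j => (hf j).1)
    (fun i j => by rw [hD.integral_comp (hf j).1, hf0])
    (fun i j => by
      rw [hD.integral_comp (f := fun o => f j o ^ 2) ((hf j).1.pow_const 2)]
      exact (hf j).2.2)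
    hM0 (fun i ω j => hfM ω i j) hM hρ h4 (2 * C - 1)
  have hset : {ω | ∀ j, |∑ i, f j (D i ω)| ≤ n * (2 * C * ρ)}ᶜ =
      {ω | ∃ j, (2 * C - 1 + 1) * (n * ρ) < |∑ i, f j (D i ω)|} := by
    ext ω
    simp only [Set.mem_compl_iff, Set.mem_ofPred_eq, not_forall, not_le]
    have : (2 * C - 1 + 1) * (n * ρ) = n * (2 * C * ρ) := by ring
    rw [this]
  rw [hset]
  refine hmax.trans (add_le_add ?_ ?_)
  · rw [hρn]
    have h1 : (Fintype.card ι : ℝ) ≤ Real.exp (3 * Real.log q) := by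
      rw [mul_comm, Real.exp_mul, Real.exp_log hq0]
      exact_mod_cast hι
    calc _ ≤ 2 * Real.exp (3 * Real.log q) *
          Real.exp (-(2 * C - 1 - V) * Real.log q + 1 / 3) := by gcongr
      _ = 2 * Real.exp (3 * Real.log q + (-(2 * C - 1 - V) * Real.log q + 1 / 3)) := by
          rw [mul_assoc, ← Real.exp_add]
      -- This requires (C − V − 4) log q ≥ 1/3, and C − V − 4 ≥ 2 while log q ≥ log 2.
      _ ≤ 2 * Real.exp (-(Real.log q * C)) := by
          gcongr
          nlinarith
      _ = _ := by rw [Real.exp_neg, Real.rpow_def_of_pos hq0]; rfl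
  · have h1 : (n * ρ) ^ 2 = n * Real.log q := by rw [← hρn]; ring
    rw [h1]
    have : 0 ≤ ∫ ω, M ω ^ 2 ∂μ := integral_nonneg fun ω => sq_nonneg _
    gcongr
    norm_num

end Sample

end Moments

/-! ### The event of accurate moments and its probability -/

section Event

variable {n p q : ℕ} {Ω : Type*} [MeasurableSpace Ω] {μ : Measure Ω} [IsProbabilityMeasure μ]
  {P : Measure (Obs p q)} {D : Fin n → Ω → Obs p q}

theorem le_iSup_of_finite {ι : Type*} [Finite ι] (f : ι → ℝ) (i : ι) : f i ≤ ⨆ i, f i :=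
  le_ciSup (Set.finite_range f).bddAbove i

omit [IsProbabilityMeasure μ] in
theorem IsIIDSample.measurableSet_forall_abs_sum_le (hD : IsIIDSample μ P D) {ι : Type*} [Finite ι]
    {f : ι → Obs p q → ℝ} (hf : ∀ j, Measurable (f j)) (t : ℝ) :
    MeasurableSet {ω | ∀ j, |∑ i, f j (D i ω)| ≤ t} := by
  have : {ω | ∀ j, |∑ i, f j (D i ω)| ≤ t} = ⋂ j, {ω | |∑ i, f j (D i ω)| ≤ t} := by
    ext ω; simp
  rw [this]
  refine MeasurableSet.iInter fun j => measurableSet_le ?_ measurable_const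
  exact (Finset.measurable_fun_sum _ fun i _ => (hf j).comp (hD.measurable i)).abs

/-- The event that the sample moments are within `ε` of their expectations. -/
def closeEvent {Ω : Type*} (P : Measure (Obs p q)) (D : Fin n → Ω → Obs p q) (ε : ℝ) : Set Ω :=
  {ω | MomentsClose P (fun i => D i ω) ε}

theorem closeEvent_eq {Ω : Type*} (P : Measure (Obs p q)) (D : Fin n → Ω → Obs p q) (ε : ℝ) :
    closeEvent P D ε =
      {ω | ∀ l, |∑ i, (fun o : Obs p q => o.z l * o.u) (D i ω)| ≤ n * ε} ∩
      {ω | ∀ a : Fin p × Fin q, |∑ i, (fun o : Obs p q => o.z a.2 * o.x a.1 -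
        ∫ o, o.z a.2 * o.x a.1 ∂P) (D i ω)| ≤ n * ε} ∩
      {ω | ∀ l, |∑ i, (fun o : Obs p q => o.z l ^ 2 * o.u ^ 2 -
        ∫ o, o.z l ^ 2 * o.u ^ 2 ∂P) (D i ω)| ≤ n * ε} ∩
      {ω | ∀ a : Fin p × Fin q, |∑ i, (fun o : Obs p q => o.z a.2 ^ 2 * o.u * o.x a.1 -
        ∫ o, o.z a.2 ^ 2 * o.u * o.x a.1 ∂P) (D i ω)| ≤ n * ε} ∩
      {ω | ∀ a : (Fin p × Fin p) × Fin q, |∑ i, (fun o : Obs p q =>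
        o.z a.2 ^ 2 * o.x a.1.1 * o.x a.1.2 -
        ∫ o, o.z a.2 ^ 2 * o.x a.1.1 * o.x a.1.2 ∂P) (D i ω)| ≤ n * ε} := by
  ext ω
  constructor
  · intro h
    exact ⟨⟨⟨⟨h.zu, fun a => h.zx _ _⟩, h.zzuu⟩, fun a => h.zzux _ _⟩, fun a => h.zzxx _ _ _⟩
  · rintro ⟨⟨⟨⟨h1, h2⟩, h3⟩, h4⟩, h5⟩
    exact ⟨h1, fun j l => h2 (j, l), h3, fun j l => h4 (j, l), fun j k l => h5 ((j, k), l)⟩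

omit [IsProbabilityMeasure μ] in
theorem IsIIDSample.measurableSet_closeEvent (hD : IsIIDSample μ P D) (ε : ℝ) :
    MeasurableSet (closeEvent P D ε) := by
  rw [closeEvent_eq]
  have m1 := hD.measurableSet_forall_abs_sum_le (f := fun l : Fin q => fun o : Obs p q =>
      o.z l * o.u) (fun _ => by fun_prop) (n * ε)
  have m2 := hD.measurableSet_forall_abs_sum_le (f := fun a : Fin p × Fin q => fun o : Obs p q =>
      o.z a.2 * o.x a.1 -
      ∫ o, o.z a.2 * o.x a.1 ∂P) (fun _ => by fun_prop) (n * ε)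
  have m3 := hD.measurableSet_forall_abs_sum_le (f := fun l : Fin q => fun o : Obs p q =>
      o.z l ^ 2 * o.u ^ 2 -
      ∫ o, o.z l ^ 2 * o.u ^ 2 ∂P) (fun _ => by fun_prop) (n * ε)
  have m4 := hD.measurableSet_forall_abs_sum_le (f := fun a : Fin p × Fin q => fun o : Obs p q =>
      o.z a.2 ^ 2 * o.u * o.x a.1 -
      ∫ o, o.z a.2 ^ 2 * o.u * o.x a.1 ∂P) (fun _ => by fun_prop) (n * ε)
  have m5 := hD.measurableSet_forall_abs_sum_le
      (f := fun a : (Fin p × Fin p) × Fin q => fun o : Obs p q =>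
      o.z a.2 ^ 2 * o.x a.1.1 * o.x a.1.2 -
      ∫ o, o.z a.2 ^ 2 * o.x a.1.1 * o.x a.1.2 ∂P) (fun _ => by fun_prop) (n * ε)
  exact (((m1.inter m2).inter m3).inter m4).inter m5

theorem card_fin_le_cube : Fintype.card (Fin q) ≤ q ^ 3 := by
  rw [Fintype.card_fin]
  exact Nat.le_self_pow (by norm_num) q

theorem card_prod_le_cube (hpq : p ≤ q) (hq : 1 ≤ q) :
    Fintype.card (Fin p × Fin q) ≤ q ^ 3 := by
  rw [Fintype.card_prod, Fintype.card_fin, Fintype.card_fin]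
  calc p * q ≤ q * q := Nat.mul_le_mul_right q hpq
    _ = q ^ 2 := (sq q).symm
    _ ≤ q ^ 3 := Nat.pow_le_pow_right hq (by norm_num)

theorem card_prod_prod_le_cube (hpq : p ≤ q) :
    Fintype.card ((Fin p × Fin p) × Fin q) ≤ q ^ 3 := by
  simp only [Fintype.card_prod, Fintype.card_fin]
  calc p * p * q ≤ q * q * q := by gcongr
    _ = q ^ 3 := by ring

section Deviations

variable [IsProbabilityMeasure P] (hD : IsIIDSample μ P D) (hn : 0 < n)
    {rx rz ru B c : ℝ} {s : ℕ} (h : MomentCondition P rx rz ru B c s) (hrx : 6 ≤ rx)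
    (hrz : 12 ≤ rz) (hru : 6 ≤ ru) (hpq : p ≤ q) (hq : 2 ≤ q) {C ρ : ℝ}
    (hρ : 0 < ρ) (hρn : n * ρ ^ 2 = Real.log q) (hC : 4 * (1 + |B|) + 6 ≤ C)

include hD hn h hrz hq hρ hρn hC

include hru in
theorem IsIIDSample.measureReal_zu_le (hM : 4 * ρ ^ 2 * EM1 μ D ≤ 1) :
    μ.real {ω | ∀ l : Fin q, |∑ i, (fun o : Obs p q => o.z l * o.u) (D i ω)| ≤ n * (2 * C * ρ)}ᶜ ≤
      2 / (q : ℝ) ^ C + 2 * EM1 μ D / (n * Real.log q) := by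
  have hDm := hD.measurable
  exact hD.measureReal_exists_lt_le hn (f := fun l : Fin q => fun o : Obs p q => o.z l * o.u)
    (M := fun ω => M1 fun i => D i ω)
    (h.zu hrz hru) h.exogenous
    (fun ω i l => (le_iSup_of_finite (fun l => |(D i ω).z l * (D i ω).u|) l).trans
      (le_iSup_of_finite (fun i => ⨆ l, |(D i ω).z l * (D i ω).u|) i))
    (fun ω => Real.iSup_nonneg fun i => Real.iSup_nonneg fun l => abs_nonneg _)
    (integrable_sq_iSup (fun i => Measurable.iSup fun l => by fun_prop) fun i =>
      integrable_sq_iSup (fun l => by fun_prop) fun l => hD.integrable_abs_sq (h.zu hrz hru l) i)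
    hq (card_fin_le_cube) hρ hρn hM hC

include hrx hpq in
theorem IsIIDSample.measureReal_zx_le (hM : 4 * ρ ^ 2 * EM2 μ P D ≤ 1) :
    μ.real {ω | ∀ a : Fin p × Fin q, |∑ i, (fun o : Obs p q => o.z a.2 * o.x a.1 -
      ∫ o, o.z a.2 * o.x a.1 ∂P) (D i ω)| ≤ n * (2 * C * ρ)}ᶜ ≤
      2 / (q : ℝ) ^ C + 2 * EM2 μ P D / (n * Real.log q) := by
  have hDm := hD.measurable
  exact hD.measureReal_exists_lt_le hn
      (f := fun a : Fin p × Fin q => fun o : Obs p q => o.z a.2 * o.x a.1 -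
      ∫ o, o.z a.2 * o.x a.1 ∂P)
    (M := fun ω => M2 P fun i => D i ω)
    (fun a : Fin p × Fin q => (h.zx hrx hrz a.1 a.2).centre.1)
    (fun a => (h.zx hrx hrz a.1 a.2).centre.2)
    (fun ω i a => ((le_iSup_of_finite (fun l => |(D i ω).z l * (D i ω).x a.1 -
        ∫ o, o.z l * o.x a.1 ∂P|) a.2).trans
      (le_iSup_of_finite (fun j => ⨆ l, |(D i ω).z l * (D i ω).x j -
        ∫ o, o.z l * o.x j ∂P|) a.1)).trans
      (le_iSup_of_finite (fun i => ⨆ j, ⨆ l, |(D i ω).z l * (D i ω).x j -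
        ∫ o, o.z l * o.x j ∂P|) i))
    (fun ω => Real.iSup_nonneg fun i => Real.iSup_nonneg fun j => Real.iSup_nonneg fun l =>
      abs_nonneg _)
    (integrable_sq_iSup (fun i => Measurable.iSup fun j => Measurable.iSup fun l => by fun_prop)
      fun i => integrable_sq_iSup (fun j => Measurable.iSup fun l => by fun_prop) fun j =>
      integrable_sq_iSup (fun l => by fun_prop) fun l =>
        hD.integrable_abs_sq (h.zx hrx hrz j l).centre.1 i)
    hq (card_prod_le_cube hpq (by omega)) hρ hρn hM hC

include hru in
theorem IsIIDSample.measureReal_zzuu_le (hM : 4 * ρ ^ 2 * EM3 μ P D ≤ 1) :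
    μ.real {ω | ∀ l : Fin q, |∑ i, (fun o : Obs p q => o.z l ^ 2 * o.u ^ 2 -
      ∫ o, o.z l ^ 2 * o.u ^ 2 ∂P) (D i ω)| ≤ n * (2 * C * ρ)}ᶜ ≤
      2 / (q : ℝ) ^ C + 2 * EM3 μ P D / (n * Real.log q) := by
  have hDm := hD.measurable
  exact hD.measureReal_exists_lt_le hn
      (f := fun l : Fin q => fun o : Obs p q => o.z l ^ 2 * o.u ^ 2 -
      ∫ o, o.z l ^ 2 * o.u ^ 2 ∂P)
    (M := fun ω => M3 P fun i => D i ω)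
    (fun l => (h.zzuu hrz hru l).centre.1) (fun l => (h.zzuu hrz hru l).centre.2)
    (fun ω i l => (le_iSup_of_finite (fun l => |(D i ω).z l ^ 2 * (D i ω).u ^ 2 -
        ∫ o, o.z l ^ 2 * o.u ^ 2 ∂P|) l).trans
      (le_iSup_of_finite (fun i => ⨆ l, |(D i ω).z l ^ 2 * (D i ω).u ^ 2 -
        ∫ o, o.z l ^ 2 * o.u ^ 2 ∂P|) i))
    (fun ω => Real.iSup_nonneg fun i => Real.iSup_nonneg fun l => abs_nonneg _)
    (integrable_sq_iSup (fun i => Measurable.iSup fun l => by fun_prop) fun i =>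
      integrable_sq_iSup (fun l => by fun_prop) fun l =>
        hD.integrable_abs_sq (h.zzuu hrz hru l).centre.1 i)
    hq (card_fin_le_cube) hρ hρn hM hC

include hrx hru hpq in
theorem IsIIDSample.measureReal_zzux_le (hM : 4 * ρ ^ 2 * EM4 μ P D ≤ 1) :
    μ.real {ω | ∀ a : Fin p × Fin q, |∑ i, (fun o : Obs p q => o.z a.2 ^ 2 * o.u * o.x a.1 -
      ∫ o, o.z a.2 ^ 2 * o.u * o.x a.1 ∂P) (D i ω)| ≤ n * (2 * C * ρ)}ᶜ ≤
      2 / (q : ℝ) ^ C + 2 * EM4 μ P D / (n * Real.log q) := by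
  have hDm := hD.measurable
  exact hD.measureReal_exists_lt_le hn
      (f := fun a : Fin p × Fin q => fun o : Obs p q => o.z a.2 ^ 2 * o.u * o.x a.1 -
      ∫ o, o.z a.2 ^ 2 * o.u * o.x a.1 ∂P)
    (M := fun ω => M4 P fun i => D i ω)
    (fun a : Fin p × Fin q => (h.zzux hrx hrz hru a.1 a.2).centre.1)
    (fun a => (h.zzux hrx hrz hru a.1 a.2).centre.2)
    (fun ω i a => ((le_iSup_of_finite (fun l => |(D i ω).z l ^ 2 * (D i ω).u * (D i ω).x a.1 -
        ∫ o, o.z l ^ 2 * o.u * o.x a.1 ∂P|) a.2).trans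
      (le_iSup_of_finite (fun j => ⨆ l, |(D i ω).z l ^ 2 * (D i ω).u * (D i ω).x j -
        ∫ o, o.z l ^ 2 * o.u * o.x j ∂P|) a.1)).trans
      (le_iSup_of_finite (fun i => ⨆ j, ⨆ l, |(D i ω).z l ^ 2 * (D i ω).u * (D i ω).x j -
        ∫ o, o.z l ^ 2 * o.u * o.x j ∂P|) i))
    (fun ω => Real.iSup_nonneg fun i => Real.iSup_nonneg fun j => Real.iSup_nonneg fun l =>
      abs_nonneg _)
    (integrable_sq_iSup (fun i => Measurable.iSup fun j => Measurable.iSup fun l => by fun_prop)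
      fun i => integrable_sq_iSup (fun j => Measurable.iSup fun l => by fun_prop) fun j =>
      integrable_sq_iSup (fun l => by fun_prop) fun l =>
        hD.integrable_abs_sq (h.zzux hrx hrz hru j l).centre.1 i)
    hq (card_prod_le_cube hpq (by omega)) hρ hρn hM hC

include hrx hpq in
theorem IsIIDSample.measureReal_zzxx_le (hM : 4 * ρ ^ 2 * EM5 μ P D ≤ 1) :
    μ.real {ω | ∀ a : (Fin p × Fin p) × Fin q, |∑ i,
      (fun o : Obs p q => o.z a.2 ^ 2 * o.x a.1.1 * o.x a.1.2 -
      ∫ o, o.z a.2 ^ 2 * o.x a.1.1 * o.x a.1.2 ∂P) (D i ω)| ≤ n * (2 * C * ρ)}ᶜ ≤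
      2 / (q : ℝ) ^ C + 2 * EM5 μ P D / (n * Real.log q) := by
  have hDm := hD.measurable
  exact hD.measureReal_exists_lt_le hn
      (f := fun a : (Fin p × Fin p) × Fin q => fun o : Obs p q => o.z a.2 ^ 2 * o.x a.1.1 * o.x a.1.2 -
      ∫ o, o.z a.2 ^ 2 * o.x a.1.1 * o.x a.1.2 ∂P)
    (M := fun ω => M5 P fun i => D i ω)
    (fun a : (Fin p × Fin p) × Fin q => (h.zzxx hrx hrz a.1.1 a.1.2 a.2).centre.1)
    (fun a => (h.zzxx hrx hrz a.1.1 a.1.2 a.2).centre.2)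
    (fun ω i a => (((le_iSup_of_finite (fun l => |(D i ω).z l ^ 2 * (D i ω).x a.1.1 *
        (D i ω).x a.1.2 - ∫ o, o.z l ^ 2 * o.x a.1.1 * o.x a.1.2 ∂P|) a.2).trans
      (le_iSup_of_finite (fun k => ⨆ l, |(D i ω).z l ^ 2 * (D i ω).x a.1.1 * (D i ω).x k -
        ∫ o, o.z l ^ 2 * o.x a.1.1 * o.x k ∂P|) a.1.2)).trans
      (le_iSup_of_finite (fun j => ⨆ k, ⨆ l, |(D i ω).z l ^ 2 * (D i ω).x j * (D i ω).x k -
        ∫ o, o.z l ^ 2 * o.x j * o.x k ∂P|) a.1.1)).trans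
      (le_iSup_of_finite (fun i => ⨆ j, ⨆ k, ⨆ l, |(D i ω).z l ^ 2 * (D i ω).x j * (D i ω).x k -
        ∫ o, o.z l ^ 2 * o.x j * o.x k ∂P|) i))
    (fun ω => Real.iSup_nonneg fun i => Real.iSup_nonneg fun j => Real.iSup_nonneg fun k =>
      Real.iSup_nonneg fun l => abs_nonneg _)
    (integrable_sq_iSup (fun i => Measurable.iSup fun j => Measurable.iSup fun k =>
      Measurable.iSup fun l => by fun_prop)
      fun i => integrable_sq_iSup (fun j => Measurable.iSup fun k => Measurable.iSup fun l =>
        by fun_prop) fun j =>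
      integrable_sq_iSup (fun k => Measurable.iSup fun l => by fun_prop) fun k =>
      integrable_sq_iSup (fun l => by fun_prop) fun l =>
        hD.integrable_abs_sq (h.zzxx hrx hrz j k l).centre.1 i)
    hq (card_prod_prod_le_cube hpq) hρ hρn hM hC

end Deviations

/-- The sample moments are close to their expectations with high probability. -/
theorem IsIIDSample.measureReal_compl_closeEvent_le (hD : IsIIDSample μ P D) (hn : 0 < n)
    {rx rz ru B c : ℝ} {s : ℕ} (h : MomentCondition P rx rz ru B c s) (hrx : 6 ≤ rx)
    (hrz : 12 ≤ rz) (hru : 6 ≤ ru) (hpq : p ≤ q) (hq : 2 ≤ q) {C ρ : ℝ}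
    (hρ : 0 < ρ) (hρn : n * ρ ^ 2 = Real.log q) (hC : 4 * (1 + |B|) + 6 ≤ C)
    (h1 : 4 * ρ ^ 2 * EM1 μ D ≤ 1) (h2 : 4 * ρ ^ 2 * EM2 μ P D ≤ 1)
    (h3 : 4 * ρ ^ 2 * EM3 μ P D ≤ 1) (h4 : 4 * ρ ^ 2 * EM4 μ P D ≤ 1)
    (h5 : 4 * ρ ^ 2 * EM5 μ P D ≤ 1) :
    μ.real (closeEvent P D (2 * C * ρ))ᶜ ≤ 10 / (q : ℝ) ^ C +
      2 * (EM1 μ D + EM2 μ P D + EM3 μ P D + EM4 μ P D + EM5 μ P D) / (n * Real.log q) := by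
  have := hD.isProbabilityMeasure hn
  have b1 := hD.measureReal_zu_le hn h hrz hru hq hρ hρn hC h1
  have b2 := hD.measureReal_zx_le hn h hrx hrz hpq hq hρ hρn hC h2
  have b3 := hD.measureReal_zzuu_le hn h hrz hru hq hρ hρn hC h3
  have b4 := hD.measureReal_zzux_le hn h hrx hrz hru hpq hq hρ hρn hC h4
  have b5 := hD.measureReal_zzxx_le hn h hrx hrz hpq hq hρ hρn hC h5
  rw [closeEvent_eq, Set.compl_inter, Set.compl_inter, Set.compl_inter, Set.compl_inter]
  refine (measureReal_union_le _ _).trans ((add_le_add ((measureReal_union_le _ _).trans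
    (add_le_add ((measureReal_union_le _ _).trans (add_le_add ((measureReal_union_le _ _).trans
    (add_le_add b1 b2)) b3)) b4)) b5).trans (le_of_eq ?_))
  ring

end Event

/-! ### Two-sided bounds on the tuning parameter -/

section TuningParameter

variable {n p q : ℕ} {Ω : Type*} [MeasurableSpace Ω] {μ : Measure Ω}
  {P : Measure (Obs p q)} {D : Fin n → Ω → Obs p q} {C : ℝ}

/-- The terms with E M_k² are dropped, and log(pq) ≥ log q. What remains mirrors the noise bound 2(m
+ ε)ε with ε = 2Cρ: the additive C is there to dominate the cross-moment bound m. -/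
theorem le_lam (hp : 1 ≤ p) (hq : 1 ≤ q) (hC : 0 < C) :
    4 * C * √(Real.log q / n) * (4 * C * √(Real.log q / n) + C) ≤ lam μ P D 2 C := by
  have hp' : (1 : ℝ) ≤ p := by exact_mod_cast hp
  have hq' : (1 : ℝ) ≤ q := by exact_mod_cast hq
  have hlog : 0 ≤ Real.log q := Real.log_nonneg hq'
  have hle : Real.log q ≤ Real.log (p * q) := Real.log_le_log (by linarith) (by nlinarith)
  have hρ : √(Real.log q) / √(n : ℝ) = √(Real.log q / n) := (Real.sqrt_div hlog _).symm
  have h1 : √(Real.log q / n) ≤ √(Real.log (p * q)) / √(n : ℝ) := by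
    rw [← hρ]; gcongr
  have h2 : 0 ≤ √(EM1 μ D) * Real.log q / n := by positivity
  have h3 : 0 ≤ √(EM2 μ P D) * Real.log (p * q) / n := by
    have := hlog.trans hle
    positivity
  unfold lam
  rw [mul_div_assoc C, mul_div_assoc C, hρ]
  have h4 := mul_le_mul_of_nonneg_left h1 hC.le
  have h5 : 0 ≤ √(Real.log q / n) := Real.sqrt_nonneg _
  apply mul_le_mul <;> first | linarith | positivity

/-- As log q / n = ρ², the first bracket is at most (4C + 4 + 1)ρ. As p ≤ q gives log(pq) ≤ 2 log q,
the second is at most 4(2C + 2) + 1 + C. -/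
theorem lam_le (hp : 1 ≤ p) (hpq : p ≤ q) (hC : 0 < C) (hρ1 : √(Real.log q / n) ≤ 1)
    (h1 : √(Real.log q / n) * √(EM1 μ D) ≤ 1) (h2 : √(Real.log q / n) * √(EM2 μ P D) ≤ 1) :
    lam μ P D 2 C ≤ (4 * C + 5) * (9 * C + 9) * √(Real.log q / n) := by
  have hp' : (1 : ℝ) ≤ p := by exact_mod_cast hp
  have hpq' : (p : ℝ) ≤ q := by exact_mod_cast hpq
  have hlog : 0 ≤ Real.log q := Real.log_nonneg (by linarith)
  have hle : Real.log (p * q) ≤ 2 * Real.log q := by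
    rw [Real.log_mul (by linarith) (by linarith)]
    linarith [Real.log_le_log (by linarith) hpq']
  have hle0 : 0 ≤ Real.log (p * q) := Real.log_nonneg (by nlinarith)
  have hρ : √(Real.log q) / √(n : ℝ) = √(Real.log q / n) := (Real.sqrt_div hlog _).symm
  set ρ := √(Real.log q / n)
  have hρ0 : 0 ≤ ρ := Real.sqrt_nonneg _
  have hρ2 : Real.log q / n = ρ ^ 2 := (Real.sq_sqrt (by positivity)).symm
  have h3 : √(Real.log (p * q)) / √(n : ℝ) ≤ 2 * ρ := by
    rw [← hρ, ← mul_div_assoc]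
    gcongr
    refine Real.sqrt_le_iff.2 ⟨by positivity, ?_⟩
    rw [mul_pow, Real.sq_sqrt hlog]
    linarith
  have h4 : √(EM1 μ D) * Real.log q / n ≤ ρ := by
    rw [mul_div_assoc, hρ2]
    nlinarith
  have h5 : √(EM2 μ P D) * Real.log (p * q) / n ≤ 2 := by
    calc √(EM2 μ P D) * Real.log (p * q) / n ≤ √(EM2 μ P D) * (2 * Real.log q) / n := by gcongr
      _ = 2 * (√(EM2 μ P D) * (Real.log q / n)) := by ring
      _ = 2 * (ρ * √(EM2 μ P D)) * ρ := by rw [hρ2]; ring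
      _ ≤ 2 * 1 * 1 := by gcongr
      _ = 2 := by norm_num
  unfold lam
  rw [mul_div_assoc C, mul_div_assoc C, hρ]
  have h6 := mul_le_mul_of_nonneg_left h3 hC.le
  have h7 : C * ρ ≤ C := by nlinarith
  have h8 : 0 ≤ √(EM2 μ P D) * Real.log (p * q) / n := by positivity
  have h9 : 0 ≤ C * (√(Real.log (p * q)) / √(n : ℝ)) := by positivity
  calc _ ≤ ((4 * C + 5) * ρ) * (9 * C + 9) := by
        apply mul_le_mul <;> linarith
    _ = _ := by ring

end TuningParameter

/-! ### The probability bound for a fixed sample size -/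

section FiniteSample

variable {n p q : ℕ} {Ω : Type*} [MeasurableSpace Ω] {μ : Measure Ω} {P : Measure (Obs p q)}
  {D : Fin n → Ω → Obs p q}

theorem integral_sq_nonneg (f : Ω → ℝ) : 0 ≤ ∫ ω, f ω ^ 2 ∂μ :=
  integral_nonneg fun ω => sq_nonneg (f ω)

theorem sq_mul_le_of_mul_sqrt_le {ρ e w : ℝ} (hρ : 0 ≤ ρ) (he : 0 ≤ e) (h : ρ * √e ≤ w) :
    ρ ^ 2 * e ≤ w ^ 2 := by
  have := pow_le_pow_left₀ (mul_nonneg hρ (Real.sqrt_nonneg e)) h 2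
  rwa [mul_pow, Real.sq_sqrt he] at this

theorem lam_nonneg (hp : 1 ≤ p) (hq : 1 ≤ q) {C : ℝ} (hC : 0 < C) : 0 ≤ lam μ P D 2 C :=
  le_trans (by positivity) (le_lam hp hq hC)

theorem sigmaSq_iInf_ge {c : ℝ} (hq : 1 ≤ q) (h : ∀ l, c ≤ sigmaSq P l) :
    c ≤ ⨅ l, sigmaSq P l := by
  have : Nonempty (Fin q) := ⟨⟨0, hq⟩⟩
  exact le_ciInf h

/-- For q = 1 the logarithm is 0 and the last quotient takes the default value 0, which leaves 1 −
21 < 0. -/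
theorem probBound_nonpos_of_eq_one (hq : q = 1) (K C : ℝ) : probBound μ P D K C ≤ 0 := by
  subst hq
  simp [probBound]

/-- From q ≥ 3 follows log q ≥ 1, hence 1/(n log q) ≤ log q / n = ρ² and E M_k²/(n log q) ≤ w². The
factor 42 is 2(5 + 10 + 2 + 2 + 2). -/
theorem le_probBound (hn : 0 < n) (hq : 3 ≤ q) {w C : ℝ}
    (h1 : √(Real.log q / n) * √(EM1 μ D) ≤ w) (h2 : √(Real.log q / n) * √(EM2 μ P D) ≤ w)
    (h3 : √(Real.log q / n) * √(EM3 μ P D) ≤ w) (h4 : √(Real.log q / n) * √(EM4 μ P D) ≤ w)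
    (h5 : √(Real.log q / n) * √(EM5 μ P D) ≤ w) :
    1 - 21 / (q : ℝ) ^ C - 42 * w ^ 2 ≤ probBound μ P D 2 C := by
  have hn' : (0 : ℝ) < n := by exact_mod_cast hn
  have hq' : (3 : ℝ) ≤ q := by exact_mod_cast hq
  have hlog : 1 ≤ Real.log q := by
    rw [Real.le_log_iff_exp_le (by linarith)]
    linarith [Real.exp_one_lt_d9]
  have hρ := Real.sqrt_nonneg (Real.log q / n)
  have g1 := sq_mul_le_of_mul_sqrt_le hρ (integral_sq_nonneg _) h1
  have g2 := sq_mul_le_of_mul_sqrt_le hρ (integral_sq_nonneg _) h2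
  have g3 := sq_mul_le_of_mul_sqrt_le hρ (integral_sq_nonneg _) h3
  have g4 := sq_mul_le_of_mul_sqrt_le hρ (integral_sq_nonneg _) h4
  have g5 := sq_mul_le_of_mul_sqrt_le hρ (integral_sq_nonneg _) h5
  rw [Real.sq_sqrt (by positivity)] at g1 g2 g3 g4 g5
  have hsum : 2 * (5 * EM1 μ D + 10 * EM2 μ P D + 2 * EM3 μ P D + 2 * EM4 μ P D +
      2 * EM5 μ P D) / (n * Real.log q) ≤ 42 * w ^ 2 := by
    have e0 : 0 ≤ 2 * (5 * EM1 μ D + 10 * EM2 μ P D + 2 * EM3 μ P D + 2 * EM4 μ P D +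
      2 * EM5 μ P D) := by
      have i1 : 0 ≤ EM1 μ D := integral_sq_nonneg _
      have i2 : 0 ≤ EM2 μ P D := integral_sq_nonneg _
      have i3 : 0 ≤ EM3 μ P D := integral_sq_nonneg _
      have i4 : 0 ≤ EM4 μ P D := integral_sq_nonneg _
      have i5 : 0 ≤ EM5 μ P D := integral_sq_nonneg _
      positivity
    have e1 : 1 / (n * Real.log q) ≤ Real.log q / n := by
      rw [div_le_div_iff₀ (by positivity) hn']
      have : 1 ≤ Real.log q * Real.log q := by nlinarith
      nlinarith
    have e2 := mul_le_mul_of_nonneg_left e1 e0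
    rw [mul_one_div] at e2
    change Real.log q / n * EM1 μ D ≤ _ at g1
    change Real.log q / n * EM2 μ P D ≤ _ at g2
    change Real.log q / n * EM3 μ P D ≤ _ at g3
    change Real.log q / n * EM4 μ P D ≤ _ at g4
    change Real.log q / n * EM5 μ P D ≤ _ at g5
    linarith
  unfold probBound
  linarith

/-- The condition w ≤ 1/2 yields 4ρ² E M_k² ≤ 1, as the maximal inequality demands. Five deviations
cost 10/q^C and twice each E M_k²/(n log q), within what `probBound` concedes. -/
theorem probBound_le_measureReal_closeEvent [IsProbabilityMeasure μ] (hD : IsIIDSample μ P D)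
    (hn : 0 < n) {rx rz ru B c : ℝ} {s : ℕ} (h : MomentCondition P rx rz ru B c s) (hrx : 6 ≤ rx)
    (hrz : 12 ≤ rz) (hru : 6 ≤ ru) (hpq : p ≤ q) (hq : 2 ≤ q) {C w : ℝ}
    (hC : 4 * (1 + |B|) + 6 ≤ C) (hw : w ≤ 1 / 2)
    (h1 : √(Real.log q / n) * √(EM1 μ D) ≤ w) (h2 : √(Real.log q / n) * √(EM2 μ P D) ≤ w)
    (h3 : √(Real.log q / n) * √(EM3 μ P D) ≤ w) (h4 : √(Real.log q / n) * √(EM4 μ P D) ≤ w)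
    (h5 : √(Real.log q / n) * √(EM5 μ P D) ≤ w) :
    probBound μ P D 2 C ≤ μ.real (closeEvent P D (2 * C * √(Real.log q / n))) := by
  have hn' : (0 : ℝ) < n := by exact_mod_cast hn
  have hq' : (2 : ℝ) ≤ q := by exact_mod_cast hq
  have hlog : 0 < Real.log q := Real.log_pos (by linarith)
  have hρ : 0 < √(Real.log q / n) := Real.sqrt_pos.2 (by positivity)
  have hρn : n * √(Real.log q / n) ^ 2 = Real.log q := by
    rw [Real.sq_sqrt (by positivity)]; field_simp
  have hquarter : ∀ e, 0 ≤ e → √(Real.log q / n) * √e ≤ w →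
      4 * √(Real.log q / n) ^ 2 * e ≤ 1 := fun e he hle => by
    have := sq_mul_le_of_mul_sqrt_le hρ.le he (hle.trans hw)
    linarith
  have i1 : 0 ≤ EM1 μ D := integral_sq_nonneg _
  have i2 : 0 ≤ EM2 μ P D := integral_sq_nonneg _
  have i3 : 0 ≤ EM3 μ P D := integral_sq_nonneg _
  have i4 : 0 ≤ EM4 μ P D := integral_sq_nonneg _
  have i5 : 0 ≤ EM5 μ P D := integral_sq_nonneg _
  have hb := hD.measureReal_compl_closeEvent_le hn h hrx hrz hru hpq hq hρ hρn hC
    (hquarter _ i1 h1) (hquarter _ i2 h2) (hquarter _ i3 h3) (hquarter _ i4 h4) (hquarter _ i5 h5)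
  rw [probReal_compl_eq_one_sub (hD.measurableSet_closeEvent _)] at hb
  have e1 : 10 / (q : ℝ) ^ C ≤ 21 / (q : ℝ) ^ C := by gcongr; norm_num
  have e2 : 2 * (EM1 μ D + EM2 μ P D + EM3 μ P D + EM4 μ P D + EM5 μ P D) / (n * Real.log q) ≤
      2 * (5 * EM1 μ D + 10 * EM2 μ P D + 2 * EM3 μ P D + 2 * EM4 μ P D + 2 * EM5 μ P D) /
        (n * Real.log q) := by
    apply div_le_div_of_nonneg_right _ (by positivity)
    linarith
  unfold probBound
  linarith

end FiniteSample

end LassoGMM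

/-! ### Asymptotics and the main theorem -/

open LassoGMM
theorem theorem1 :
    ∃ K : ℝ, 0 < K ∧
    ∀ rx rz ru B : ℝ, 6 ≤ rx → 12 ≤ rz → 6 ≤ ru →
    ∃ C : ℝ, 0 < C ∧
    ∀ (Ω : ℕ → Type*) [∀ n, MeasurableSpace (Ω n)]
      (μ : ∀ n, Measure (Ω n)) [∀ n, IsProbabilityMeasure (μ n)]
      (p q s : ℕ → ℕ) (P : ∀ n, Measure (Obs (p n) (q n)))
      (D : ∀ n, Fin n → Ω n → Obs (p n) (q n)) (c : ℝ),
      -- dimensions: at least as many instruments as regressors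
      (∀ n, 1 ≤ p n) → (∀ n, p n ≤ q n) → (∀ n, 1 ≤ s n) →
      -- for each `n`, an i.i.d. sample of size `n` from `P n`
      (∀ n, IsIIDSample (μ n) (P n) (D n)) →
      -- moment conditions, uniformly in `n`
      0 < c → (∀ n, MomentCondition (P n) rx rz ru B c (s n)) →
      -- growth conditions
      Tendsto (fun n : ℕ => (s n : ℝ) ^ 2 * √(Real.log (q n) / n)) atTop (𝓝 0) →
      Tendsto (fun n : ℕ => √(Real.log (q n)) / √(n : ℝ) *
        max √(EM1 (μ n) (D n)) (max √(EM2 (μ n) (P n) (D n)) (max √(EM3 (μ n) (P n) (D n))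
          (max √(EM4 (μ n) (P n) (D n)) √(EM5 (μ n) (P n) (D n))))))
        atTop (𝓝 0) →
      -- rate of the tuning parameter
      ((fun n => lamStar (μ n) (P n) (D n) K C) =O[atTop]
        fun n : ℕ => √(Real.log (q n) / n)) ∧
      -- oracle inequality, simultaneously over the `ℓ₀`-ball, on the events `A n`
      ∃ A : ∀ n, Set (Ω n), (∀ n, MeasurableSet (A n)) ∧
        (∀ᶠ n in atTop,
          probBound (μ n) (P n) (D n) K C ≤ (μ n).real (A n) ∧
          ∀ ω ∈ A n, ∀ β₀ : Fin (p n) → ℝ, l0 β₀ ≤ s n →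
            let X := regressors fun i => D n i ω
            let Z := instruments fun i => D n i ω
            let Y := outcomes (fun i => D n i ω) β₀
            let t := lam (μ n) (P n) (D n) K C
            let t' := lamStar (μ n) (P n) (D n) K C
            (∃ bF, IsFirstStep X Z Y t bF) ∧
            ∀ bF, IsFirstStep X Z Y t bF →
              (∀ l, 0 < sigmaHatSq X Z Y bF l) ∧
              (∃ b, IsTwoStep X Z Y bF t' b) ∧
              ∀ b, IsTwoStep X Z Y bF t' b →
                l1 (b - β₀) ≤ 24 * t' * s n / phiSq (P n) (s n)) ∧
        -- the probability tends to one as soon as the number of instruments diverges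
        (Tendsto q atTop atTop → Tendsto (fun n => (μ n).real (A n)) atTop (𝓝 1)) := by
  -- K = 2 suffices, and C = V + 6 for the common second-moment bound V = 4(1 + |B|).
  refine ⟨2, two_pos, fun rx rz ru B hrx hrz hru => ⟨4 * (1 + |B|) + 6, by positivity, ?_⟩⟩
  intro Ω _ μ _ p q s P D c hp hpq hs hD hc hP hS hM
  set C : ℝ := 4 * (1 + |B|) + 6 with hCdef
  have hC : 0 < C := by positivity
  set ρ : ℕ → ℝ := fun n => √(Real.log (q n) / n)
  set w : ℕ → ℝ := fun n => √(Real.log (q n)) / √(n : ℝ) *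
    max √(EM1 (μ n) (D n)) (max √(EM2 (μ n) (P n) (D n)) (max √(EM3 (μ n) (P n) (D n))
      (max √(EM4 (μ n) (P n) (D n)) √(EM5 (μ n) (P n) (D n)))))
  have hq1 : ∀ n, 1 ≤ q n := fun n => (hp n).trans (hpq n)
  have hρ0 : ∀ n, 0 ≤ ρ n := fun n => Real.sqrt_nonneg _
  have hρw : ∀ n, √(Real.log (q n)) / √(n : ℝ) = ρ n := fun n =>
    (Real.sqrt_div (Real.log_nonneg (by exact_mod_cast hq1 n)) _).symm
  have hw : ∀ n e, e ≤ max √(EM1 (μ n) (D n)) (max √(EM2 (μ n) (P n) (D n))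
      (max √(EM3 (μ n) (P n) (D n)) (max √(EM4 (μ n) (P n) (D n)) √(EM5 (μ n) (P n) (D n))))) →
      ρ n * e ≤ w n := fun n e he => by
    simp only [w]
    rw [hρw]
    exact mul_le_mul_of_nonneg_left he (hρ0 n)
  have hw1 : ∀ n, ρ n * √(EM1 (μ n) (D n)) ≤ w n := fun n => hw n _ (by simp)
  have hw2 : ∀ n, ρ n * √(EM2 (μ n) (P n) (D n)) ≤ w n := fun n => hw n _ (by simp)
  have hw3 : ∀ n, ρ n * √(EM3 (μ n) (P n) (D n)) ≤ w n := fun n => hw n _ (by simp)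
  have hw4 : ∀ n, ρ n * √(EM4 (μ n) (P n) (D n)) ≤ w n := fun n => hw n _ (by simp)
  have hw5 : ∀ n, ρ n * √(EM5 (μ n) (P n) (D n)) ≤ w n := fun n => hw n _ (by simp)
  have hs1 : ∀ n, (1 : ℝ) ≤ s n := fun n => by exact_mod_cast hs n
  -- As s ≥ 1, both sρ and ρ are at most s²ρ.
  have hsρ : Tendsto (fun n => (s n : ℝ) * ρ n) atTop (𝓝 0) :=
    squeeze_zero (fun n => mul_nonneg (Nat.cast_nonneg _) (hρ0 n))
      (fun n => mul_le_mul_of_nonneg_right (by nlinarith [hs1 n]) (hρ0 n)) hS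
  have hρt : Tendsto ρ atTop (𝓝 0) :=
    squeeze_zero hρ0 (fun n => le_mul_of_one_le_left (hρ0 n) (hs1 n)) hsρ
  set Λ : ℝ := (4 * C + 5) * (9 * C + 9)
  have hlam : ∀ᶠ n in atTop, lam (μ n) (P n) (D n) 2 C ≤ Λ * ρ n := by
    filter_upwards [hρt.eventually_le_const one_pos, hM.eventually_le_const one_pos] with n h1 h2
    exact lam_le (hp n) (hpq n) hC h1 ((hw1 n).trans h2) ((hw2 n).trans h2)
  -- For q = 1 the probability bound is negative and the empty event serves; log q > 0 is thus
  -- available on `A n`.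
  set A : ∀ n, Set (Ω n) := fun n => if 2 ≤ q n then closeEvent (P n) (D n) (2 * C * ρ n) else ∅
  have hA : ∀ᶠ n in atTop, probBound (μ n) (P n) (D n) 2 C ≤ (μ n).real (A n) := by
    filter_upwards [hM.eventually_le_const (show (0 : ℝ) < 1 / 2 by norm_num),
      eventually_gt_atTop 0] with n h1 hn
    by_cases h : 2 ≤ q n
    · simp only [A, if_pos h]
      exact probBound_le_measureReal_closeEvent (hD n) hn (hP n) hrx hrz hru (hpq n) h le_rfl h1
        (hw1 n) (hw2 n) (hw3 n) (hw4 n) (hw5 n)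
    · exact (probBound_nonpos_of_eq_one (by have := hq1 n; omega) _ _).trans measureReal_nonneg
  refine ⟨?_, A, fun n => ?_, ?_, fun hqt => ?_⟩
  · refine IsBigO.of_bound (Λ * (2 / c)) ?_
    filter_upwards [hlam] with n h
    have hinf := sigmaSq_iInf_ge (hq1 n) (hP n).sigmaSq_ge
    have hl := lam_nonneg (μ := μ n) (P := P n) (D := D n) (hp n) (hq1 n) hC
    have hinf0 : 0 < ⨅ l, sigmaSq (P n) l := hc.trans_le hinf
    rw [lamStar, Real.norm_of_nonneg (by positivity), Real.norm_of_nonneg (hρ0 n)]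
    calc _ ≤ Λ * ρ n * (2 / c) := by gcongr
      _ = _ := by ring
  · simp only [A]
    split_ifs
    · exact (hD n).measurableSet_closeEvent _
    · exact MeasurableSet.empty
  -- An upper bound for the first-step ℓ₁ error 12 λ_n s / c², obtained from λ_n ≤ Λρ.
  · set r : ℕ → ℝ := fun n => 12 * Λ / c ^ 2 * (s n * ρ n)
    have hr : Tendsto r atTop (𝓝 0) := by simpa using hsρ.const_mul (12 * Λ / c ^ 2)
    have hε : Tendsto (fun n => 2 * C * ρ n) atTop (𝓝 0) := by simpa using hρt.const_mul (2 * C)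
    have hsmall1 : ∀ᶠ n in atTop, 96 * s n * (2 * C * ρ n) ^ 2 ≤ c ^ 2 := by
      have : Tendsto (fun n => 96 * (2 * C) ^ 2 * (s n * ρ n * ρ n)) atTop (𝓝 0) := by
        simpa using (hsρ.mul hρt).const_mul (96 * (2 * C) ^ 2)
      filter_upwards [this.eventually_le_const (show 0 < c ^ 2 by positivity)] with n h
      linarith
    have hsmall2 : ∀ᶠ n in atTop, 2 * C * ρ n + 2 * ((1 + 4 * (1 + |B|) + 2 * C * ρ n) * r n) +
        (1 + 4 * (1 + |B|) + 2 * C * ρ n) * r n ^ 2 ≤ c / 2 := by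
      have h1 := hε.const_add (1 + 4 * (1 + |B|))
      have := (hε.add ((h1.mul hr).const_mul 2)).add (h1.mul (hr.pow 2))
      simp only [mul_zero, add_zero, ne_eq, OfNat.ofNat_ne_zero, not_false_eq_true,
        zero_pow] at this
      exact this.eventually_le_const (by positivity)
    filter_upwards [hA, hlam, hsmall1, hsmall2, eventually_gt_atTop 0] with n h1 h2 h3 h4 hn
    refine ⟨h1, fun ω hω β₀ hβ => ?_⟩
    have hq2 : 2 ≤ q n := by
      by_contra h
      simp [A, h] at hω
    simp only [A, if_pos hq2] at hω
    have := (hD n).isProbabilityMeasure hn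
    have hn' : (0 : ℝ) < n := by exact_mod_cast hn
    have hlog : 0 < Real.log (q n) := Real.log_pos (by exact_mod_cast hq2)
    have hρpos : 0 < ρ n := Real.sqrt_pos.2 (by positivity)
    refine twoStep_oracle hn (hq1 n) hc (by positivity) (hP n).phiSq_ge (hP n).sigmaSq_ge
      ((hP n).crossMomentsBounded hrx hrz hru) (by positivity) hω h3 ?_ ?_ h4 hβ
    · refine le_trans ?_ (le_lam (hp n) (hq1 n) hC)
      change 2 * ((1 + 4 * (1 + |B|) + 2 * C * ρ n) * (2 * C * ρ n)) ≤
        4 * C * ρ n * (4 * C * ρ n + C)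
      -- The cross-moment bound m = 1 + 4(1 + |B|) is smaller than C by 5.
      have h5 : 1 + 4 * (1 + |B|) + 2 * C * ρ n ≤ 4 * C * ρ n + C := by
        have := mul_nonneg hC.le (hρ0 n)
        linarith
      have h6 := mul_le_mul_of_nonneg_left h5 (show 0 ≤ 4 * C * ρ n by positivity)
      linarith
    · calc 12 * lam (μ n) (P n) (D n) 2 C * s n / c ^ 2 ≤ 12 * (Λ * ρ n) * s n / c ^ 2 := by gcongr
        _ = r n := by simp only [r]; ring
  · have hqC : Tendsto (fun n => 21 / (q n : ℝ) ^ C) atTop (𝓝 0) :=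
      ((tendsto_rpow_atTop hC).comp (tendsto_natCast_atTop_atTop.comp hqt)).const_div_atTop 21
    have hlow : Tendsto (fun n => 1 - 21 / (q n : ℝ) ^ C - 42 * w n ^ 2) atTop (𝓝 1) := by
      simpa using (hqC.const_sub 1).sub ((hM.pow 2).const_mul 42)
    refine tendsto_of_tendsto_of_tendsto_of_le_of_le' hlow tendsto_const_nhds ?_
      (Eventually.of_forall fun n => measureReal_le_one)
    filter_upwards [hA, hqt.eventually_ge_atTop 3, eventually_gt_atTop 0] with n h1 h2 hn
    exact (le_probBound hn h2 (hw1 n) (hw2 n) (hw3 n) (hw4 n) (hw5 n)).trans h1
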